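/- Let $\mathcal F$ be the category of finite cardinals, and let $[\mathcal F,\mathbf{Set}]$ carry the substitution monoidal structure $(A\otimes B)(n)=\int^{m}Am\times (Bn)^m$, corresponding to composition of finitary endofunctors of $\mathbf{Set}$. An $[\mathcal F,\mathbf{Set}]$-category $\mathcal M$ is thus given by objects, sets $\mathcal M_n(X,Y)$ ($n\in\mathbb N$), projections $\pi_1,\dots,\pi_n\in\mathcal M_n(X,X)$ and substitutions $(g,f_1,\dots,f_m)\mapsto g\circ(f_1,\dots,f_m)$, $\mathcal M_m(Y,Z)\times\mathcal M_n(X,Y)^m\to\mathcal M_n(X,Z)$, satisfying the (many-object) abstract clone axioms; its underlying ordinary category $V\mathcal M$ has homs $\mathcal M_1(X,Y)$. A finitary monad $\mathsf S$ on $\mathbf{Set}$ yields a one-object $[\mathcal F,\mathbf{Set}]$-category $\Sigma\mathsf S$ with homs $\mathsf S(n)$. A category $\mathcal C$ with finite powers yields an $[\mathcal F,\mathbf{Set}]$-category $R\mathcal C$ with the objects of $\mathcal C$ and $R\mathcal C_n(X,Y)=\mathcal C(X^n,Y)$; one has $VR\mathcal C\cong\mathcal C$. The Lawvere theory $\mathcal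 S$ associated to $\mathsf S$ has as objects the powers $A^n$ ($n\in\mathbb N$) of a distinguished object $A$, and $\mathcal S(A^n,A^m)=\mathsf S(n)^m$; write $\eta:\Sigma\mathsf S\to R\mathcal S$ for the canonical fully faithful $[\mathcal F,\mathbf{Set}]$-functor picking out $A$. All left Kan extensions below are pointwise: $\mathrm{Lan}_FG$ is computed at each object $B$ by the weighted colimit $\mathcal B(F-,B)\star G$, which in the $[\mathcal F,\mathbf{Set}]$-case is an enriched one. Let $F:\mathsf S\to\mathsf T$ be a map of finitary monads on $\mathbf{Set}$, let $G:\mathcal S\to\mathcal T$ be the associated map of Lawvere theories, let $\Sigma F:\Sigma\mathsf S\to\Sigma\mathsf T$ and $RG:R\mathcal S\to R\mathcal T$ be the induced $[\mathcal F,\mathbf{Set}]$-functors, and let $\mathcal C$ be a (locally small, possibly large) category with finite powers. **(1)** For every $\mathcal S$-model in $\mathcal C$, i.e. every $[\mathcal F,\mathbf{Set}]$-functor $X:R\mathcal S\to R\mathcal C$, the following are equivalent, where $VX:\mathcal S\to\mathcal C$ is the underlying ordinary functor: (i) the enriched Kan extension $\mathrm{Lan}_{RG}(X):R\mathcal T\to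 R\mathcal C$ exists; (ii) the enriched Kan extension $\mathrm{Lan}_{\Sigma F}(X\eta):\Sigma\mathsf T\to R\mathcal C$ exists; (iii) the ordinary functor $D: G\downarrow A\xrightarrow{\pi_1}\mathcal S\xrightarrow{VX}\mathcal C$, where $A$ is the distinguished object of $\mathcal T$, admits a colimit which distributes over finite powers; that is, there is a colimiting cocone $i:D\Rightarrow\Delta Z$ such that for every $k\in\mathbb N$ the induced cocone $i^k:D^k\Rightarrow\Delta(Z^k)$, with components $i_{a_1}\times\dots\times i_{a_k}$, is colimiting for the functor $D^k:(G\downarrow A)^k\to\mathcal C$, $(a_1,\dots,a_k)\mapsto Da_1\times\dots\times Da_k$; (iv) the unenriched Kan extension $\mathrm{Lan}_G(VX):\mathcal T\to\mathcal C$ exists and preserves finite powers. **(2)** If $\mathrm{Lan}_{RG}(X)$ exists for all $[\mathcal F,\mathbf{Set}]$-functors $X:R\mathcal S\to R\mathcal C$, then these Kan extensions are the values of a left adjoint, whose unit is formed by the universal transformations $X\Rightarrow \mathrm{Lan}_{RG}(X)\circ RG$, to the algebraic functor $\mathrm{Mod}(\mathcal T,\mathcal C)\to\mathrm{Mod}(\mathcal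 S,\mathcal C)$ given by precomposition with $RG$, where $\mathrm{Mod}(\mathcal T,\mathcal C)$ is the category of $[\mathcal F,\mathbf{Set}]$-functors $R\mathcal T\to R\mathcal C$ and transformations. Likewise, if $\mathrm{Lan}_{\Sigma F}(Y)$ exists for all $[\mathcal F,\mathbf{Set}]$-functors $Y:\Sigma\mathsf S\to R\mathcal C$, then these Kan extensions are the values of a left adjoint, with unit given by the universal transformations, to the algebraic functor $\mathrm{Alg}(\mathsf T,\mathcal C)\to\mathrm{Alg}(\mathsf S,\mathcal C)$ given by precomposition with $\Sigma F$, where $\mathrm{Alg}(\mathsf T,\mathcal C)$ is the category of $[\mathcal F,\mathbf{Set}]$-functors $\Sigma\mathsf T\to R\mathcal C$ and transformations. -/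

import Mathlib

open CategoryTheory Limits

universe w₄ w₃ w₂ w₁ v₄ v₃ v₂ v₁ u v

/-! ## `[𝓕, Set]`-categories, functors and transformations

`𝓕` is the category of finite cardinals; `[𝓕, Set]` carries the substitution monoidal structure
(composition of finitary endofunctors of `Set`).  Categories enriched in it are presented in their
elementary form, as many-object abstract clones; the reindexing along `φ : n → m` is
`g ↦ g ∘ (π_{φ 1}, …, π_{φ n})` and the identities are the elements `π₁ ∈ M₁(X, X)`. -/

/-- An `[𝓕, Set]`-category, given by homsets `Mₙ(X, Y)`, projections and substitution. -/
structure FSetCat where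
  Obj : Type v₁
  hom : ℕ → Obj → Obj → Type w₁
  proj : ∀ {n : ℕ} {X : Obj}, Fin n → hom n X X
  comp : ∀ {m n : ℕ} {X Y Z : Obj}, hom m Y Z → (Fin m → hom n X Y) → hom n X Z
  proj_comp : ∀ {n k : ℕ} {X Y : Obj} (i : Fin n) (f : Fin n → hom k X Y), comp (proj i) f = f i
  comp_proj : ∀ {n : ℕ} {X Y : Obj} (g : hom n X Y), comp g (fun i => proj i) = g
  assoc : ∀ {j k l : ℕ} {W X Y Z : Obj} (h : hom j Y Z) (g : Fin j → hom k X Y)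
    (f : Fin k → hom l W X), comp (comp h g) f = comp h (fun i => comp (g i) f)

/-- An `[𝓕, Set]`-functor. -/
structure FSetFunctor (M : FSetCat.{w₁, v₁}) (N : FSetCat.{w₂, v₂}) where
  obj : M.Obj → N.Obj
  map : ∀ {n : ℕ} {X Y : M.Obj}, M.hom n X Y → N.hom n (obj X) (obj Y)
  map_proj : ∀ {n : ℕ} {X : M.Obj} (i : Fin n),
    map (M.proj i : M.hom n X X) = N.proj i
  map_comp : ∀ {m n : ℕ} {X Y Z : M.Obj} (g : M.hom m Y Z) (f : Fin m → M.hom n X Y),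
    map (M.comp g f) = N.comp (map g) (fun i => map (f i))

/-- Composition of `[𝓕, Set]`-functors (in diagrammatic order). -/
def FSetFunctor.then {M : FSetCat.{w₁, v₁}} {N : FSetCat.{w₂, v₂}} {P : FSetCat.{w₃, v₃}}
    (F : FSetFunctor M N) (G : FSetFunctor N P) : FSetFunctor M P where
  obj X := G.obj (F.obj X)
  map f := G.map (F.map f)
  map_proj i := by rw [F.map_proj, G.map_proj]
  map_comp g f := by rw [F.map_comp, G.map_comp]

/-- An `[𝓕, Set]`-transformation: elements `α_X ∈ N₁(FX, GX)` such that
`α_Y ∘ Ff = Gf ∘ (α_X ∘ π₁, …, α_X ∘ πₙ)` for all `f ∈ Mₙ(X, Y)`. -/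
@[ext]
structure FSetTrans {M : FSetCat.{w₁, v₁}} {N : FSetCat.{w₂, v₂}} (F G : FSetFunctor M N) where
  app : ∀ X : M.Obj, N.hom 1 (F.obj X) (G.obj X)
  naturality : ∀ {n : ℕ} {X Y : M.Obj} (f : M.hom n X Y),
    N.comp (app Y) (fun _ : Fin 1 => F.map f) =
      N.comp (G.map f) (fun i : Fin n => N.comp (app X) (fun _ : Fin 1 => N.proj i))

/-- In an `[𝓕, Set]`-category, substituting `π₁` into a unary element does nothing. -/
theorem FSetCat.comp_proj_one (N : FSetCat.{w₂, v₂}) {X Y : N.Obj} (g : N.hom 1 X Y) :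
    N.comp g (fun _ : Fin 1 => N.proj 0) = g := by
  have h : (fun _ : Fin 1 => (N.proj 0 : N.hom 1 X X)) = fun i => N.proj i := by
    funext i; rw [Subsingleton.elim i 0]
  rw [h, N.comp_proj]

/-- The category of `[𝓕, Set]`-functors `M → N` and `[𝓕, Set]`-transformations. -/
instance FSetFunctor.category (M : FSetCat.{w₁, v₁}) (N : FSetCat.{w₂, v₂}) :
    Category (FSetFunctor M N) where
  Hom F G := FSetTrans F G
  id F :=
    { app := fun X => N.proj 0
      naturality := fun f => by simp only [N.proj_comp, N.comp_proj] }
  comp {F G H} α β :=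
    { app := fun X => N.comp (β.app X) (fun _ : Fin 1 => α.app X)
      naturality := fun {n X Y} f => by
        simp only [N.assoc]
        rw [α.naturality f, ← N.assoc, β.naturality f, N.assoc]
        simp only [N.assoc, N.proj_comp] }
  id_comp α := by
    apply FSetTrans.ext; funext X; exact N.comp_proj_one _
  comp_id α := by
    apply FSetTrans.ext; funext X; exact N.proj_comp _ _
  assoc α β γ := by
    apply FSetTrans.ext; funext X; exact (N.assoc _ _ _).symm

/-- Precomposition with an `[𝓕, Set]`-functor `F : A → B`, as an ordinary functor
`[𝓕, Set]-CAT(B, D) ⥤ [𝓕, Set]-CAT(A, D)`. -/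
def FSetFunctor.precomp {A : FSetCat.{w₁, v₁}} {B : FSetCat.{w₂, v₂}} (F : FSetFunctor A B)
    (D : FSetCat.{w₃, v₃}) : FSetFunctor B D ⥤ FSetFunctor A D where
  obj L := F.then L
  map α :=
    { app := fun X => FSetTrans.app α (F.obj X)
      naturality := fun f => FSetTrans.naturality α (F.map f) }
  map_id _ := rfl
  map_comp _ _ := rfl

/-! ## Weighted colimits and (pointwise) left Kan extensions -/

/-- A presheaf (right module) on an `[𝓕, Set]`-category `A`: objects `P(X) ∈ [𝓕, Set]` with an
action `P(X) ⊗ A(Y, X) → P(Y)`.  As for homs, reindexing is given by acting with projections. -/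
structure FSetPresheaf (A : FSetCat.{w₁, v₁}) where
  obj : ℕ → A.Obj → Type w₂
  act : ∀ {m n : ℕ} {X Y : A.Obj}, obj m X → (Fin m → A.hom n Y X) → obj n Y
  act_proj : ∀ {n : ℕ} {X : A.Obj} (p : obj n X), act p (fun i => A.proj i) = p
  act_act : ∀ {j k l : ℕ} {X Y Z : A.Obj} (p : obj j X) (g : Fin j → A.hom k Y X)
    (f : Fin k → A.hom l Z Y), act (act p g) f = act p (fun i => A.comp (g i) f)

/-- The presheaf `B(F –, Y)` on `A`, for an `[𝓕, Set]`-functor `F : A → B` and an object `Y`. -/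
def FSetFunctor.homPresheaf {A : FSetCat.{w₁, v₁}} {B : FSetCat.{w₂, v₂}} (F : FSetFunctor A B)
    (Y : B.Obj) : FSetPresheaf.{w₂} A where
  obj n X := B.hom n (F.obj X) Y
  act p f := B.comp p (fun i => F.map (f i))
  act_proj p := by simp only [F.map_proj, B.comp_proj]
  act_act p g f := by simp only [B.assoc, F.map_comp]

/-- A map of presheaves. -/
structure FSetPresheaf.Map {A : FSetCat.{w₁, v₁}} (P : FSetPresheaf.{w₂} A)
    (Q : FSetPresheaf.{w₃} A) where
  app : ∀ {n : ℕ} {X : A.Obj}, P.obj n X → Q.obj n X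
  app_act : ∀ {m n : ℕ} {X Y : A.Obj} (p : P.obj m X) (f : Fin m → A.hom n Y X),
    app (P.act p f) = Q.act (app p) f

/-- The value at `k` of the hom-object `𝓟A(P, Q) ∈ [𝓕, Set]` of the `[𝓕, Set]`-category of
presheaves on `A`.  It is the sub-object, cut out by compatibility with the actions, of
`∏_X [PX, QX](k)`, where `[B, C](k) = ∫ₙ [(Bn)ᵏ, Cn]` is the right closed structure. -/
@[ext]
structure FSetPresheaf.Hom {A : FSetCat.{w₁, v₁}} (k : ℕ) (P : FSetPresheaf.{w₂} A)
    (Q : FSetPresheaf.{w₃} A) where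
  app : ∀ {n : ℕ} {X : A.Obj}, (Fin k → P.obj n X) → Q.obj n X
  app_act : ∀ {m n : ℕ} {X Y : A.Obj} (p : Fin k → P.obj m X) (f : Fin m → A.hom n Y X),
    app (fun j => P.act (p j) f) = Q.act (app p) f

/-- The value at `k` of the map `D(Z, Y) → 𝓟A(W, D(G –, Y))` in `[𝓕, Set]` induced by
`i : W → D(G –, Z)`; it sends `g` to `(w₁, …, w_k) ↦ g ∘ (i w₁, …, i w_k)`. -/
def weightedComparison {A : FSetCat.{w₁, v₁}} {D : FSetCat.{w₂, v₂}} {W : FSetPresheaf.{w₃} A}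
    {G : FSetFunctor A D} {Z : D.Obj} (i : W.Map (G.homPresheaf Z)) (Y : D.Obj) (k : ℕ)
    (g : D.hom k Z Y) : FSetPresheaf.Hom k W (G.homPresheaf Y) where
  app w := D.comp g (fun j => i.app (w j))
  app_act {m n X Y'} w f := by
    have h : ∀ j, i.app (W.act (w j) f) = D.comp (i.app (w j)) (fun l => G.map (f l)) :=
      fun j => i.app_act (w j) f
    simp only [h]
    exact (D.assoc _ _ _).symm

/-- `i : W → D(G –, Z)` exhibits `Z` as the `[𝓕, Set]`-enriched weighted colimit `W ⋆ G`. -/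
def IsWeightedColimit {A : FSetCat.{w₁, v₁}} {D : FSetCat.{w₂, v₂}} {W : FSetPresheaf.{w₃} A}
    {G : FSetFunctor A D} {Z : D.Obj} (i : W.Map (G.homPresheaf Z)) : Prop :=
  ∀ (Y : D.Obj) (k : ℕ), Function.Bijective (weightedComparison i Y k)

/-- For `α : G ⇒ L F`, the induced map of presheaves `B(F –, Y) → D(G –, L Y)`,
`w ↦ L w ∘ (α ∘ π₁, …, α ∘ πₙ)`. -/
def lanLeg {A : FSetCat.{w₁, v₁}} {B : FSetCat.{w₂, v₂}} {D : FSetCat.{w₃, v₃}}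
    {F : FSetFunctor A B} {G : FSetFunctor A D} {L : FSetFunctor B D} (α : FSetTrans G (F.then L))
    (Y : B.Obj) : (F.homPresheaf Y).Map (G.homPresheaf (L.obj Y)) where
  app {n X} w := D.comp (L.map w)
    (fun j : Fin n => D.comp (α.app X) (fun _ : Fin 1 => D.proj j))
  app_act {m n X X'} w f := by
    have h : ∀ i, D.comp (L.map (F.map (f i)))
        (fun j : Fin n => D.comp (α.app X') (fun _ : Fin 1 => D.proj j)) =
        D.comp (α.app X) (fun _ : Fin 1 => G.map (f i)) :=
      fun i => (α.naturality (f i)).symm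
    have e : L.map (B.comp w (fun i => F.map (f i))) =
        D.comp (L.map w) (fun i => L.map (F.map (f i))) := L.map_comp _ _
    refine (congrArg (fun t => D.comp t _) e).trans ((D.assoc _ _ _).trans ?_)
    refine Eq.trans ?_ (D.assoc _ _ _).symm
    refine congrArg (D.comp (L.map w)) (funext fun i => (h i).trans ?_)
    refine Eq.trans ?_ (D.assoc _ _ _).symm
    exact congrArg (D.comp _) (funext fun _ => (D.proj_comp i (fun i => G.map (f i))).symm)

/-- `α : G ⇒ L F` exhibits `L` as the `[𝓕, Set]`-enriched left Kan extension `Lan_F G`: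
at each object `Y` it exhibits `L Y` as the weighted colimit `B(F –, Y) ⋆ G`. -/
def IsLan {A : FSetCat.{w₁, v₁}} {B : FSetCat.{w₂, v₂}} {D : FSetCat.{w₃, v₃}}
    (F : FSetFunctor A B) (G : FSetFunctor A D) (L : FSetFunctor B D) (α : FSetTrans G (F.then L)) : Prop :=
  ∀ Y : B.Obj, IsWeightedColimit (lanLeg α Y)

/-- The `[𝓕, Set]`-enriched left Kan extension `Lan_F G` exists. -/
def HasLan {A : FSetCat.{w₁, v₁}} {B : FSetCat.{w₂, v₂}} {D : FSetCat.{w₃, v₃}}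
    (F : FSetFunctor A B) (G : FSetFunctor A D) : Prop :=
  ∃ (L : FSetFunctor B D) (α : FSetTrans G (F.then L)), IsLan F G L α

/-! ## Underlying categories; categories with finite powers -/

/-- The objects of the underlying ordinary category `V M`. -/
structure FSetCat.Underlying (M : FSetCat.{w₁, v₁}) : Type v₁ where
  as : M.Obj

/-- The underlying ordinary category `V M`, with homs `M₁(X, Y)`. -/
instance FSetCat.underlyingCategory (M : FSetCat.{w₁, v₁}) : Category.{w₁} M.Underlying where
  Hom X Y := M.hom 1 X.as Y.as
  id X := M.proj 0
  comp f g := M.comp g (fun _ : Fin 1 => f)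
  id_comp g := M.comp_proj_one g
  comp_id _ := M.proj_comp _ _
  assoc _ _ _ := (M.assoc _ _ _).symm

/-- The underlying ordinary functor `V F : V M ⥤ V N`. -/
def FSetFunctor.underlying {M : FSetCat.{w₁, v₁}} {N : FSetCat.{w₂, v₂}} (F : FSetFunctor M N) :
    M.Underlying ⥤ N.Underlying where
  obj X := ⟨F.obj X.as⟩
  map f := F.map f
  map_id _ := F.map_proj _
  map_comp _ _ := F.map_comp _ _

/-- `C` has finite powers: an `n`-fold product `Xⁿ` of each object with itself, for all `n`. -/
class HasFinitePowers (C : Type v₁) [Category.{w₁} C] : Prop where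
  hasProduct : ∀ (n : ℕ) (X : C), HasProduct (fun _ : Fin n => X)

instance hasProduct_power (C : Type v₁) [Category.{w₁} C] [HasFinitePowers C] (n : ℕ) (X : C) :
    HasProduct (fun _ : Fin n => X) :=
  HasFinitePowers.hasProduct n X

/-- The power `Xⁿ`. -/
noncomputable abbrev power {C : Type v₁} [Category.{w₁} C] [HasFinitePowers C] (n : ℕ) (X : C) :
    C :=
  ∏ᶜ (fun _ : Fin n => X)

/-- A functor preserves finite powers. -/
class PreservesFinitePowers {C : Type v₁} [Category.{w₁} C] {D : Type v₂} [Category.{w₂} D]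
    (F : C ⥤ D) : Prop where
  preserves : ∀ (n : ℕ) (X : C), PreservesLimit (Discrete.functor (fun _ : Fin n => X)) F

instance preservesLimit_power {C : Type v₁} [Category.{w₁} C] {D : Type v₂} [Category.{w₂} D]
    (F : C ⥤ D) [PreservesFinitePowers F] (n : ℕ) (X : C) :
    PreservesLimit (Discrete.functor (fun _ : Fin n => X)) F :=
  PreservesFinitePowers.preserves n X

theorem power_lift_proj {C : Type v₁} [Category.{w₁} C] [HasFinitePowers C] (n : ℕ) (X : C) :
    Pi.lift (fun i => Pi.π (fun _ : Fin n => X) i) = 𝟙 (power n X) := by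
  apply Pi.hom_ext; intro i; simp

theorem power_comp_lift {C : Type v₁} [Category.{w₁} C] [HasFinitePowers C] {n : ℕ} {W V X : C}
    (f : W ⟶ V) (g : Fin n → (V ⟶ X)) :
    f ≫ Pi.lift (f := fun _ : Fin n => X) g = Pi.lift (fun i => f ≫ g i) := by
  apply Pi.hom_ext; intro i; simp

/-- The `[𝓕, Set]`-category `R C` of a category with finite powers: `(R C)ₙ(X, Y) = C(Xⁿ, Y)`. -/
noncomputable def reprCat (C : Type v₁) [Category.{w₁} C] [HasFinitePowers C] :
    FSetCat.{w₁, v₁} where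
  Obj := C
  hom n X Y := power n X ⟶ Y
  proj {_ X} i := Pi.π (fun _ => X) i
  comp g f := Pi.lift f ≫ g
  proj_comp i f := by simp
  comp_proj g := by rw [power_lift_proj, Category.id_comp]
  assoc h g f := by rw [← Category.assoc, power_comp_lift]

theorem map_power_lift {C : Type v₁} [Category.{w₁} C] [HasFinitePowers C] {D : Type v₂}
    [Category.{w₂} D] [HasFinitePowers D] (G : C ⥤ D) [PreservesFinitePowers G]
    {m : ℕ} {W Y : C} (f : Fin m → (W ⟶ Y)) :
    G.map (Pi.lift (f := fun _ : Fin m => Y) f) =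
      Pi.lift (fun i => G.map (f i)) ≫ inv (piComparison G (fun _ : Fin m => Y)) := by
  rw [IsIso.eq_comp_inv]
  simp

/-- The `[𝓕, Set]`-functor `R G` of a finite-power-preserving functor `G`, with action on homs
`C(Xⁿ, Y) → D(G(Xⁿ), GY) ≅ D((GX)ⁿ, GY)`. -/
noncomputable def reprFunctor {C : Type v₁} [Category.{w₁} C] [HasFinitePowers C] {D : Type v₂}
    [Category.{w₂} D] [HasFinitePowers D] (G : C ⥤ D) [PreservesFinitePowers G] :
    FSetFunctor (reprCat C) (reprCat D) where
  obj (X : C) := G.obj X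
  map {n} {X Y : C} f := inv (piComparison G (fun _ : Fin n => X)) ≫ G.map f
  map_proj {n} {X : C} i := by
    change inv (piComparison G (fun _ : Fin n => X)) ≫ G.map (Pi.π (fun _ : Fin n => X) i) =
      Pi.π (fun _ : Fin n => G.obj X) i
    simp
  map_comp {m n} {X Y Z : C} (g : power m Y ⟶ Z) (f : Fin m → (power n X ⟶ Y)) := by
    change inv (piComparison G (fun _ : Fin n => X)) ≫ G.map (Pi.lift f ≫ g) =
      Pi.lift (fun i => inv (piComparison G (fun _ : Fin n => X)) ≫ G.map (f i)) ≫
        inv (piComparison G (fun _ : Fin m => Y)) ≫ G.map g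
    rw [G.map_comp, map_power_lift, ← power_comp_lift]
    simp only [Category.assoc]

/-- The comparison `C ⥤ V R C`, precomposing with `X¹ ≅ X` (half of the isomorphism
`V R C ≅ C`). -/
noncomputable def toUnderlyingRepr (C : Type v₁) [Category.{w₁} C] [HasFinitePowers C] :
    C ⥤ (reprCat C).Underlying where
  obj X := ⟨X⟩
  map {X Y} f := (Pi.π (fun _ : Fin 1 => X) 0 ≫ f : power 1 X ⟶ Y)
  map_id X := by
    change Pi.π (fun _ : Fin 1 => X) 0 ≫ 𝟙 X = Pi.π (fun _ : Fin 1 => X) 0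
    simp
  map_comp {X Y Z} f g := by
    change Pi.π (fun _ : Fin 1 => X) 0 ≫ f ≫ g =
      Pi.lift (fun _ : Fin 1 => Pi.π (fun _ : Fin 1 => X) 0 ≫ f) ≫
        Pi.π (fun _ : Fin 1 => Y) 0 ≫ g
    simp

/-- The isomorphism `X → X¹`. -/
noncomputable def toPowerOne {C : Type v₁} [Category.{w₁} C] [HasFinitePowers C] (X : C) :
    X ⟶ power 1 X :=
  Pi.lift (fun _ : Fin 1 => 𝟙 X)

theorem toPowerOne_proj {C : Type v₁} [Category.{w₁} C] [HasFinitePowers C] (X : C) :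
    toPowerOne X ≫ Pi.π (fun _ : Fin 1 => X) 0 = 𝟙 X := by
  simp [toPowerOne]

theorem toPowerOne_comp {C : Type v₁} [Category.{w₁} C] [HasFinitePowers C] {X Y Z : C}
    (f : power 1 X ⟶ Y) (g : power 1 Y ⟶ Z) :
    toPowerOne X ≫ Pi.lift (fun _ : Fin 1 => f) ≫ g =
      (toPowerOne X ≫ f) ≫ toPowerOne Y ≫ g := by
  rw [← Category.assoc, ← Category.assoc, toPowerOne, toPowerOne, power_comp_lift,
    power_comp_lift, Category.comp_id]

/-- The comparison `V R C ⥤ C`, precomposing with `X ≅ X¹` (the other half of the isomorphism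
`V R C ≅ C`). -/
noncomputable def ofUnderlyingRepr (C : Type v₁) [Category.{w₁} C] [HasFinitePowers C] :
    (reprCat C).Underlying ⥤ C where
  obj X := (X.as : C)
  map {X Y} f := toPowerOne (C := C) X.as ≫ show power (C := C) 1 X.as ⟶ Y.as from f
  map_id X := toPowerOne_proj (C := C) X.as
  map_comp {X Y Z} f g := toPowerOne_comp (C := C) (X := X.as) (Y := Y.as) (Z := Z.as) f g

/-- The ordinary functor `V X : B ⥤ C` underlying an `[𝓕, Set]`-functor `X : R B → R C`, under
the identifications `V R B ≅ B` and `V R C ≅ C`. -/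
noncomputable def FSetFunctor.ordinary {B : Type v₁} [Category.{w₁} B] [HasFinitePowers B]
    {C : Type v₂} [Category.{w₂} C] [HasFinitePowers C] (X : FSetFunctor (reprCat B) (reprCat C)) :
    B ⥤ C :=
  toUnderlyingRepr B ⋙ X.underlying ⋙ ofUnderlyingRepr C

/-! ## Finitary monads and their Lawvere theories -/

/-- The set `S(n)` of `n`-ary operations of a (finitary) monad `S` on `Set`. -/
abbrev Ops (S : CategoryTheory.Monad (Type u)) (n : ℕ) : Type u :=
  S.obj (ULift.{u} (Fin n))

/-- The `i`-th projection in `S(n)`, given by the unit of `S`. -/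
def Ops.var (S : CategoryTheory.Monad (Type u)) {n : ℕ} (i : Fin n) : Ops S n :=
  S.η.app (ULift.{u} (Fin n)) ⟨i⟩

/-- Substitution `S(m) × S(n)ᵐ → S(n)`, given by Kleisli extension. -/
def Ops.subst (S : CategoryTheory.Monad (Type u)) {m n : ℕ} (g : Ops S m) (f : Fin m → Ops S n) :
    Ops S n :=
  S.μ.app (ULift.{u} (Fin n))
    (S.map (TypeCat.ofHom fun i : ULift.{u} (Fin m) => f i.down) g)

theorem Ops.var_subst (S : CategoryTheory.Monad (Type u)) {m n : ℕ} (i : Fin m)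
    (f : Fin m → Ops S n) : Ops.subst S (Ops.var S i) f = f i := by
  have h := ConcreteCategory.congr_hom
    (S.η.naturality (TypeCat.ofHom fun i : ULift.{u} (Fin m) => f i.down)) (ULift.up i : ULift.{u} (Fin m))
  have h' := ConcreteCategory.congr_hom (S.left_unit (ULift.{u} (Fin n))) (f i)
  exact (congrArg (S.μ.app (ULift.{u} (Fin n))) h.symm).trans h'

theorem Ops.subst_var (S : CategoryTheory.Monad (Type u)) {n : ℕ} (g : Ops S n) :
    Ops.subst S g (fun i => Ops.var S i) = g :=
  ConcreteCategory.congr_hom (S.right_unit (ULift.{u} (Fin n))) g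

theorem Ops.subst_subst (S : CategoryTheory.Monad (Type u)) {j k l : ℕ} (h : Ops S j)
    (g : Fin j → Ops S k) (f : Fin k → Ops S l) :
    Ops.subst S (Ops.subst S h g) f = Ops.subst S h (fun i => Ops.subst S (g i) f) := by
  have e : S.map (TypeCat.ofHom fun i : ULift.{u} (Fin j) => g i.down) ≫
      S.μ.app _ ≫ S.map (TypeCat.ofHom fun i : ULift.{u} (Fin k) => f i.down) ≫ S.μ.app _ =
      S.map (TypeCat.ofHom fun i : ULift.{u} (Fin j) => Ops.subst S (g i.down) f) ≫
        S.μ.app (ULift.{u} (Fin l)) := by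
    rw [← S.mu_naturality_assoc, ← S.assoc, ← Functor.map_comp_assoc, ← Functor.map_comp_assoc]
    rfl
  exact ConcreteCategory.congr_hom e h

/-- The one-object `[𝓕, Set]`-category `Σ S` of a (finitary) monad on `Set`: its hom-object is
`n ↦ S(n)`. -/
def sigmaCat (S : CategoryTheory.Monad (Type u)) : FSetCat.{u, 0} where
  Obj := PUnit
  hom n _ _ := Ops S n
  proj i := Ops.var S i
  comp g f := Ops.subst S g f
  proj_comp i f := Ops.var_subst S i f
  comp_proj g := Ops.subst_var S g
  assoc h g f := Ops.subst_subst S h g f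

/-- The action `S(n) → T(n)` of a map of monads. -/
def Ops.map {S T : CategoryTheory.Monad (Type u)} (F : S ⟶ T) {n : ℕ} (f : Ops S n) : Ops T n :=
  F.toNatTrans.app (ULift.{u} (Fin n)) f

theorem Ops.map_var {S T : CategoryTheory.Monad (Type u)} (F : S ⟶ T) {n : ℕ} (i : Fin n) :
    Ops.map F (Ops.var S i) = Ops.var T i :=
  ConcreteCategory.congr_hom (MonadHom.app_η F (ULift.{u} (Fin n)))
    (ULift.up i : ULift.{u} (Fin n))

theorem Ops.map_subst {S T : CategoryTheory.Monad (Type u)} (F : S ⟶ T) {m n : ℕ} (g : Ops S m)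
    (f : Fin m → Ops S n) :
    Ops.map F (Ops.subst S g f) = Ops.subst T (Ops.map F g) (fun i => Ops.map F (f i)) := by
  have e : S.map (TypeCat.ofHom fun i : ULift.{u} (Fin m) => f i.down) ≫
      S.μ.app _ ≫ F.toNatTrans.app _ = F.toNatTrans.app _ ≫
        T.map (TypeCat.ofHom fun i : ULift.{u} (Fin m) => Ops.map F (f i.down)) ≫
          T.μ.app (ULift.{u} (Fin n)) := by
    rw [MonadHom.app_μ, Category.assoc, ← Functor.map_comp_assoc]
    exact F.toNatTrans.naturality_assoc
      (TypeCat.ofHom fun i : ULift.{u} (Fin m) => Ops.map F (f i.down)) (T.μ.app _)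
  exact ConcreteCategory.congr_hom e g

/-- The `[𝓕, Set]`-functor `Σ F : Σ S → Σ T` of a map of monads `F : S → T`. -/
def sigmaMap {S T : CategoryTheory.Monad (Type u)} (F : S ⟶ T) :
    FSetFunctor (sigmaCat S) (sigmaCat T) where
  obj _ := PUnit.unit
  map f := Ops.map F f
  map_proj i := Ops.map_var F i
  map_comp g f := Ops.map_subst F g f

/-- The objects of the Lawvere theory associated to a monad `S`: the finite powers `Aⁿ` (indexed
by the arity `n`) of a distinguished object `A`. -/
structure LawvereTheory (S : CategoryTheory.Monad (Type u)) where
  arity : ℕ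

/-- A map `Aⁿ → Aᵐ` in the Lawvere theory of `S`: an `m`-tuple of elements of `S(n)`. -/
@[ext]
structure LawvereTheory.Hom {S : CategoryTheory.Monad (Type u)} (a b : LawvereTheory S) :
    Type u where
  ops : Fin b.arity → Ops S a.arity

/-- The Lawvere theory associated to `S`, with composition given by substitution. -/
instance LawvereTheory.category (S : CategoryTheory.Monad (Type u)) :
    Category.{u} (LawvereTheory S) where
  Hom a b := LawvereTheory.Hom a b
  id _ := ⟨fun i => Ops.var S i⟩
  comp f g := ⟨fun i => Ops.subst S (g.ops i) f.ops⟩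
  id_comp _ := LawvereTheory.Hom.ext (funext fun _ => Ops.subst_var S _)
  comp_id _ := LawvereTheory.Hom.ext (funext fun _ => Ops.var_subst S _ _)
  assoc _ _ _ := LawvereTheory.Hom.ext (funext fun _ => (Ops.subst_subst S _ _ _).symm)

/-- The distinguished object `A` of the Lawvere theory. -/
abbrev LawvereTheory.gen (S : CategoryTheory.Monad (Type u)) : LawvereTheory S := ⟨1⟩

/-- The canonical fan on `n` copies of `Aᵐ` with vertex `Aⁿᵐ`. -/
def LawvereTheory.fan {S : CategoryTheory.Monad (Type u)} (n : ℕ) (a : LawvereTheory S) :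
    Fan (fun _ : Fin n => a) :=
  Fan.mk (⟨n * a.arity⟩ : LawvereTheory S)
    (fun i => (⟨fun j => Ops.var S (finProdFinEquiv (i, j))⟩ : LawvereTheory.Hom _ _))

/-- The canonical fan is a product. -/
def LawvereTheory.isLimitFan {S : CategoryTheory.Monad (Type u)} (n : ℕ) (a : LawvereTheory S) :
    IsLimit (LawvereTheory.fan n a) :=
  Fan.IsLimit.mk _
    (fun s => (⟨fun l => LawvereTheory.Hom.ops (s.proj (finProdFinEquiv.symm l).1)
      (finProdFinEquiv.symm l).2⟩ : LawvereTheory.Hom _ _))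
    (fun s i => LawvereTheory.Hom.ext (funext fun j => by
      refine (Ops.var_subst S (finProdFinEquiv (i, j)) _).trans ?_
      simp only [Equiv.symm_apply_apply]))
    (fun s m hm => LawvereTheory.Hom.ext (funext fun l => by
      obtain ⟨⟨i, j⟩, rfl⟩ := finProdFinEquiv.surjective l
      have h := congrFun (congrArg LawvereTheory.Hom.ops (hm i)) j
      simp only [Equiv.symm_apply_apply]
      exact (Ops.var_subst S (finProdFinEquiv (i, j)) _).symm.trans h))

instance LawvereTheory.hasFinitePowers (S : CategoryTheory.Monad (Type u)) :
    HasFinitePowers (LawvereTheory S) where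
  hasProduct n a := ⟨⟨_, LawvereTheory.isLimitFan n a⟩⟩

/-- The map of Lawvere theories associated to a map of monads. -/
def theoryMap {S T : CategoryTheory.Monad (Type u)} (F : S ⟶ T) :
    LawvereTheory S ⥤ LawvereTheory T where
  obj a := ⟨a.arity⟩
  map f := ⟨fun i => Ops.map F (f.ops i)⟩
  map_id _ := LawvereTheory.Hom.ext (funext fun i => Ops.map_var F i)
  map_comp f g := LawvereTheory.Hom.ext (funext fun i => Ops.map_subst F (g.ops i) f.ops)

instance theoryMap_preservesFinitePowers {S T : CategoryTheory.Monad (Type u)} (F : S ⟶ T) :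
    PreservesFinitePowers (theoryMap F) where
  preserves n a := by
    refine preservesLimit_of_preserves_limit_cone (LawvereTheory.isLimitFan n a)
      ((isLimitMapConeFanMkEquiv (theoryMap F) _ _).symm ?_)
    refine IsLimit.ofIsoLimit (LawvereTheory.isLimitFan n ((theoryMap F).obj a))
      (Fan.ext (Iso.refl (⟨n * a.arity⟩ : LawvereTheory T)) fun i => ?_)
    refine Eq.trans ?_ (Category.id_comp _).symm
    exact LawvereTheory.Hom.ext (funext fun j => (Ops.map_var F _).symm)

/-- The map `Aⁿ → A` in the Lawvere theory named by an operation, where `Aⁿ` is the power of `A`: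
the composite of the canonical map from `Aⁿ` to the object of arity `n` with the operation. -/
noncomputable def LawvereTheory.ofOp (S : CategoryTheory.Monad (Type u)) {n : ℕ} (f : Ops S n) :
    power n (LawvereTheory.gen S) ⟶ LawvereTheory.gen S :=
  (⟨fun i => LawvereTheory.Hom.ops (Pi.π (fun _ : Fin n => LawvereTheory.gen S) i) 0⟩ :
      power n (LawvereTheory.gen S) ⟶ (⟨n⟩ : LawvereTheory S)) ≫
    (⟨fun _ => f⟩ : (⟨n⟩ : LawvereTheory S) ⟶ LawvereTheory.gen S)

theorem LawvereTheory.ofOp_var (S : CategoryTheory.Monad (Type u)) {n : ℕ} (i : Fin n) :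
    LawvereTheory.ofOp S (Ops.var S i) = Pi.π (fun _ : Fin n => LawvereTheory.gen S) i := by
  refine LawvereTheory.Hom.ext (funext fun j => ?_)
  obtain rfl := Subsingleton.elim j (0 : Fin 1)
  exact Ops.var_subst S i _

theorem LawvereTheory.ofOp_subst (S : CategoryTheory.Monad (Type u)) {m n : ℕ} (g : Ops S m)
    (f : Fin m → Ops S n) :
    LawvereTheory.ofOp S (Ops.subst S g f) =
      Pi.lift (fun i => LawvereTheory.ofOp S (f i)) ≫ LawvereTheory.ofOp S g := by
  have h (i : Fin m) := congrFun (congrArg LawvereTheory.Hom.ops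
    (Pi.lift_π (f := fun _ : Fin m => LawvereTheory.gen S)
      (fun i => LawvereTheory.ofOp S (f i)) i)) (0 : Fin 1)
  refine LawvereTheory.Hom.ext (funext fun j => ?_)
  refine (Ops.subst_subst S g f _).trans ?_
  exact (Eq.trans (Ops.subst_subst S g _ _) (congrArg (Ops.subst S g) (funext fun i => h i))).symm

/-- The `[𝓕, Set]`-functor `η : Σ S → R 𝒮` into the Lawvere theory `𝒮` of `S`, picking out the
distinguished object `A` and sending `f ∈ S(n)` to the map `Aⁿ → A` that it names. -/
noncomputable def theoryUnit (S : CategoryTheory.Monad (Type u)) :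
    FSetFunctor (sigmaCat S) (reprCat (LawvereTheory S)) where
  obj _ := LawvereTheory.gen S
  map f := LawvereTheory.ofOp S f
  map_proj i := LawvereTheory.ofOp_var S i
  map_comp g f := LawvereTheory.ofOp_subst S g f

/-! ## Colimits distributing over finite powers -/

/-- The functor `Dᵏ : Jᵏ ⥤ C`, `(a₁, …, a_k) ↦ D a₁ × ⋯ × D a_k`. -/
noncomputable def powerDiagram {J : Type v₁} [Category.{w₁} J] {C : Type v₂} [Category.{w₂} C]
    (D : J ⥤ C) (k : ℕ) [∀ a : Fin k → J, HasProduct (fun i => D.obj (a i))] :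
    (Fin k → J) ⥤ C where
  obj a := ∏ᶜ (fun i => D.obj (a i))
  map f := Limits.Pi.map (fun i => D.map (f i))

/-- The cocone `iᵏ : Dᵏ ⇒ Δ(Zᵏ)` induced by a cocone `i : D ⇒ ΔZ`, with components
`i_{a₁} × ⋯ × i_{a_k}`. -/
noncomputable def powerCocone {J : Type v₁} [Category.{w₁} J] {C : Type v₂} [Category.{w₂} C]
    [HasFinitePowers C] {D : J ⥤ C} (c : Cocone D) (k : ℕ)
    [∀ a : Fin k → J, HasProduct (fun i => D.obj (a i))] : Cocone (powerDiagram D k) where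
  pt := power k c.pt
  ι :=
    { app := fun a => Limits.Pi.map (fun i => c.ι.app (a i))
      naturality := fun a b f => by
        apply Pi.hom_ext; intro i
        simp [powerDiagram] }

/-- `D` admits a colimit which distributes over finite powers: there is a colimiting cocone `i`
such that every `iᵏ` is colimiting.  (The products `D a₁ × ⋯ × D a_k` exist automatically when
the values of `D` are powers of a fixed object, the only case in which this notion is used.) -/
def HasDistributiveColimit {J : Type v₁} [Category.{w₁} J] {C : Type v₂} [Category.{w₂} C]
    [HasFinitePowers C] (D : J ⥤ C) : Prop :=
  ∃ c : Cocone D, Nonempty (IsColimit c) ∧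
    ∀ k : ℕ, ∃ _ : ∀ a : Fin k → J, HasProduct (fun i => D.obj (a i)),
      Nonempty (IsColimit (powerCocone c k))

/-! ## Universal property of pointwise Kan extensions -/

section Universal

variable {A : FSetCat.{w₁, v₁}} {B : FSetCat.{w₂, v₂}} {D : FSetCat.{w₃, v₃}}

/-! Everything is compared with one notion, the power family: maps `E(G a, b)ᵏ → C(H a, Q)` natural
in `a`. A cocone on `G ↓ b` with vertex `Z` is called a power colimit (`IsPowerColimit`) if, for
every `k`, maps `Zᵏ ⟶ Q` correspond to power families of exponent `k`. Each of the four conditions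
amounts to having such cocones.

Every `[𝓕, Set]`-functor `R B → R C` is `R H` for a power-preserving `H`
(`FSetFunctor.reprFunctor_ordinary`), so `X` may be taken to be `R H`. An element of the enriched
presheaf hom of exponent `k` is then a power family. Over `R 𝒮`, an `n`-ary element at `a` is a
unary one at `aⁿ` (`reprHomEquiv`); over `Σ S`, `T(n)` is `𝒯(Aⁿ, A)` and `C((H A)ⁿ, Q)` is `C(H Aⁿ,
Q)` (`sigmaHomEquiv`). So (i) concerns power colimits at all `b`, and (ii) implies that there is one
at `A`.

For (iii), finite products exist in `𝒮` and `H` preserves them, so a cocone under `Dᵏ` is determined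
by its values on tuples of objects of `G ↓ A` with a common source, and these form a power family
(`hasDistributiveColimit_iff`). For (iv), a `k`-tuple of maps `G a ⟶ b` is one map `G a ⟶ bᵏ`, so
`L(bᵏ) ≅ (L b)ᵏ` represents power families (`isPowerColimit_coconeAt`). Conversely a power colimit
`Z` at `A` suffices: put `L(Aⁿ) = Zⁿ` (`IsPowerColimit.exists_pointwiseLeftKanExtension`).

For part (2), a pointwise extension has the usual universal property (`IsLan.existsUnique`), and the
resulting bijections of homs assemble into an adjunction. -/

theorem IsWeightedColimit.hom_ext {W : FSetPresheaf.{w₂} A} {G : FSetFunctor A D} {Z : D.Obj}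
    {i : W.Map (G.homPresheaf Z)} (hi : IsWeightedColimit i) {Y : D.Obj} {k : ℕ}
    {g g' : D.hom k Z Y}
    (h : ∀ (n : ℕ) (X : A.Obj) (w : Fin k → W.obj n X),
      D.comp g (fun j => i.app (w j)) = D.comp g' (fun j => i.app (w j))) : g = g' := by
  refine (hi Y k).1 (FSetPresheaf.Hom.ext ?_)
  funext n X w
  exact h n X w

variable {F : FSetFunctor A B} {G : FSetFunctor A D} {L : FSetFunctor B D}
  {α : FSetTrans G (F.then L)}

/-- The elements of `D(G –, L Y)` making up `lanLeg α Y`. -/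
def lanElement (α : FSetTrans G (F.then L)) {Y : B.Obj} {n : ℕ} {X : A.Obj}
    (w : B.hom n (F.obj X) Y) : D.hom n (G.obj X) (L.obj Y) :=
  D.comp (L.map w) (fun j : Fin n => D.comp (α.app X) (fun _ : Fin 1 => D.proj j))

theorem comp_map_lanElement {Y Y' : B.Obj} {k n : ℕ} {X : A.Obj} (f : B.hom k Y Y')
    (w : Fin k → B.hom n (F.obj X) Y) :
    D.comp (L.map f) (fun j => lanElement α (w j)) = lanElement α (B.comp f w) := by
  simp only [lanElement, L.map_comp]
  exact (D.assoc _ _ _).symm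

/-- The Yoneda step: `α` is recovered by evaluating at the identity element. -/
theorem lanElement_proj (X : A.Obj) :
    lanElement α (B.proj 0 : B.hom 1 (F.obj X) (F.obj X)) = α.app X := by
  rw [lanElement, L.map_proj, D.proj_comp]
  exact D.comp_proj_one _

/-- Naturality moves `w` across `γ`, so on these elements `γ` depends only on its composite with
`α`. This gives uniqueness in the universal property. -/
theorem trans_comp_lanElement {H : FSetFunctor B D} (γ : FSetTrans L H) {Y : B.Obj} {n : ℕ}
    {X : A.Obj} (w : B.hom n (F.obj X) Y) :
    D.comp (γ.app Y) (fun _ : Fin 1 => lanElement α w) =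
      D.comp (H.map w) (fun j : Fin n =>
        D.comp (D.comp (γ.app (F.obj X)) (fun _ : Fin 1 => α.app X))
          (fun _ : Fin 1 => D.proj j)) := by
  have key (a : D.hom 1 (G.obj X) (L.obj (F.obj X))) :
      D.comp (γ.app Y) (fun _ : Fin 1 => D.comp (L.map w)
        (fun j : Fin n => D.comp a (fun _ : Fin 1 => D.proj j))) =
      D.comp (H.map w) (fun j : Fin n => D.comp (D.comp (γ.app (F.obj X)) (fun _ : Fin 1 => a))
        (fun _ : Fin 1 => D.proj j)) := by
    have e := congrArg (fun t => D.comp t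
      (fun j : Fin n => D.comp a (fun _ : Fin 1 => D.proj j))) (γ.naturality w)
    simpa only [D.assoc, D.proj_comp] using e
  exact key (α.app X)

theorem IsLan.hom_ext (h : IsLan F G L α) {Y : B.Obj} {Z : D.Obj} {k : ℕ}
    {g g' : D.hom k (L.obj Y) Z}
    (e : ∀ (n : ℕ) (X : A.Obj) (w : Fin k → B.hom n (F.obj X) Y),
      D.comp g (fun j => lanElement α (w j)) = D.comp g' (fun j => lanElement α (w j))) :
    g = g' :=
  (h Y).hom_ext e

theorem IsLan.exists_comp_eq (h : IsLan F G L α) {H : FSetFunctor B D}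
    (β : FSetTrans G (F.then H)) (Y : B.Obj) :
    ∃ g : D.hom 1 (L.obj Y) (H.obj Y), ∀ (n : ℕ) (X : A.Obj) (w : B.hom n (F.obj X) Y),
      D.comp g (fun _ : Fin 1 => lanElement α w) = lanElement β w := by
  obtain ⟨g, hg⟩ := (h Y (H.obj Y) 1).2
    -- A map of presheaves is the same as an element of the presheaf hom of exponent 1, so
    -- surjectivity at `k = 1` applies to the legs of `β`.
    { app := fun w => (lanLeg β Y).app (w 0)
      app_act := fun w f => (lanLeg β Y).app_act (w 0) f }
  exact ⟨g, fun n X w => congrFun (congrFun (congrFun (congrArg FSetPresheaf.Hom.app hg) n) X)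
      (fun _ => w)⟩

/-- The universal property of a pointwise left Kan extension. -/
theorem IsLan.existsUnique (h : IsLan F G L α) (H : FSetFunctor B D)
    (β : FSetTrans G (F.then H)) :
    ∃! γ : L ⟶ H, CategoryStruct.comp (X := G) (Y := (F.precomp D).obj L) α
      ((F.precomp D).map γ) = β := by
  choose γ hγ using h.exists_comp_eq β
  refine ⟨{ app := γ, naturality := ?_ }, ?_, ?_⟩
  · intro n Y Y' f
    -- Both sides are `n`-ary elements, so naturality needs injectivity in exponent `n`, although
    -- `γ` itself came from exponent 1.
    refine h.hom_ext fun m X w => ?_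
    simp only [D.assoc, D.proj_comp, comp_map_lanElement, hγ]
  · refine FSetTrans.ext ?_
    funext X
    have h1 := hγ (F.obj X) 1 X (B.proj 0)
    rw [lanElement_proj] at h1
    exact h1.trans (lanElement_proj X)
  · intro γ' hγ'
    refine FSetTrans.ext ?_
    funext Y
    refine h.hom_ext fun m X w => ?_
    obtain ⟨w, rfl⟩ : ∃ w₀, w = fun _ => w₀ :=
      ⟨w 0, funext fun j => by rw [Subsingleton.elim j 0]⟩
    refine (trans_comp_lanElement γ' w).trans ((hγ Y m X w).trans ?_).symm
    rw [← hγ']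
    rfl

/-- If all pointwise left Kan extensions along `F` exist, they form a left adjoint to
precomposition with `F`, whose unit consists of the universal transformations. -/
theorem exists_adjunction_of_hasLan (F : FSetFunctor A B)
    (h : ∀ G : FSetFunctor A D, HasLan F G) :
    ∃ (Φ : FSetFunctor A D ⥤ FSetFunctor B D) (adj : Φ ⊣ F.precomp D),
      ∀ G, IsLan F G (Φ.obj G) (adj.unit.app G) := by
  choose L α hα using h
  let e : ∀ (G : FSetFunctor A D) (H : FSetFunctor B D),
      (L G ⟶ H) ≃ (G ⟶ (F.precomp D).obj H) := fun G H =>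
    Equiv.ofBijective
      (fun γ => CategoryStruct.comp (X := G) (Y := (F.precomp D).obj (L G)) (α G)
        ((F.precomp D).map γ))
      ((Function.bijective_iff_existsUnique _).2 fun β => (hα G).existsUnique H β)
  have he : ∀ G H H' (g : H ⟶ H') (γ : L G ⟶ H), e G H' (γ ≫ g) =
      e G H γ ≫ (F.precomp D).map g := by
    intro G H H' g γ
    simp only [e, Equiv.ofBijective_apply, Functor.map_comp]
    exact (Category.assoc _ _ _).symm
  refine ⟨_, Adjunction.adjunctionOfEquivLeft e he, fun G => ?_⟩
  -- The unit is the image of the identity under `e`, and `e` composes with `α G`.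
  have hu : (Adjunction.adjunctionOfEquivLeft e he).unit.app G = α G := by
    simp only [Adjunction.adjunctionOfEquivLeft_unit_app, e, Equiv.ofBijective_apply,
      CategoryTheory.Functor.map_id]
    exact Category.comp_id _
  rw [hu]
  exact hα G

end Universal

/-! ## `[𝓕, Set]`-functors between categories with finite powers -/

section Repr

variable {B : Type v₁} [Category.{w₁} B] [HasFinitePowers B]
  {C : Type v₂} [Category.{w₂} C] [HasFinitePowers C]

/-- The action on homs of an `[𝓕, Set]`-functor `R B → R C`. -/
def FSetFunctor.reprMap (X : FSetFunctor (reprCat B) (reprCat C)) {n : ℕ} {a b : B}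
    (f : power n a ⟶ b) : power n (X.ordinary.obj a) ⟶ X.ordinary.obj b :=
  X.map (M := reprCat B) (N := reprCat C) (X := a) (Y := b) f

theorem FSetFunctor.reprMap_π (X : FSetFunctor (reprCat B) (reprCat C)) {n : ℕ} {a : B}
    (i : Fin n) : X.reprMap (Pi.π (fun _ : Fin n => a) i) = Pi.π _ i :=
  X.map_proj (X := a) i

theorem FSetFunctor.reprMap_lift_comp (X : FSetFunctor (reprCat B) (reprCat C)) {m n : ℕ}
    {a b c : B} (g : power m b ⟶ c) (f : Fin m → (power n a ⟶ b)) :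
    X.reprMap (Pi.lift f ≫ g) = Pi.lift (fun i => X.reprMap (f i)) ≫ X.reprMap g :=
  X.map_comp (M := reprCat B) (X := a) (Y := b) (Z := c) g f

theorem FSetFunctor.ordinary_map (X : FSetFunctor (reprCat B) (reprCat C)) {a b : B}
    (f : a ⟶ b) :
    X.ordinary.map f = toPowerOne (X.ordinary.obj a) ≫ X.reprMap (Pi.π (fun _ : Fin 1 => a) 0 ≫ f) :=
  rfl

theorem toPowerOne_lift {C : Type v₁} [Category.{w₁} C] [HasFinitePowers C] {X Y Z : C}
    (f : Fin 1 → (power 1 X ⟶ Y)) (g : power 1 Y ⟶ Z) :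
    toPowerOne X ≫ Pi.lift f ≫ g = Pi.lift (fun i => toPowerOne X ≫ f i) ≫ g := by
  rw [← Category.assoc, power_comp_lift]

theorem comp_toPowerOne {C : Type v₁} [Category.{w₁} C] [HasFinitePowers C] {X Y : C}
    (f : X ⟶ Y) : f ≫ toPowerOne Y = Pi.lift (fun _ : Fin 1 => f) := by
  rw [toPowerOne, power_comp_lift, Category.comp_id]

/-- The identity of `aⁿ` is an `n`-ary element from `a` to `aⁿ`, and `f` arises by substituting it
into `f` read as a unary element. The whole action on homs is thus governed by the ordinary functor
and the images of these identities. -/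
theorem FSetFunctor.reprMap_id_comp_ordinary_map (X : FSetFunctor (reprCat B) (reprCat C))
    {n : ℕ} {a b : B} (f : power n a ⟶ b) :
    X.reprMap (𝟙 (power n a)) ≫ X.ordinary.map f = X.reprMap f := by
  have h : f = Pi.lift (fun _ : Fin 1 => 𝟙 (power n a)) ≫
      Pi.π (fun _ : Fin 1 => power n a) 0 ≫ f := by simp
  rw [X.ordinary_map]
  conv_rhs => rw [h, X.reprMap_lift_comp]
  rw [← comp_toPowerOne, Category.assoc]

/-- The image of the universal element `𝟙 (aⁿ)` inverts the comparison map. Hence preservation of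
finite powers is automatic for an `[𝓕, Set]`-functor. -/
theorem FSetFunctor.piComparison_ordinary (X : FSetFunctor (reprCat B) (reprCat C))
    {n : ℕ} {a : B} :
    piComparison X.ordinary (fun _ : Fin n => a) ≫ X.reprMap (𝟙 (power n a)) = 𝟙 _ := by
  have h : piComparison X.ordinary (fun _ : Fin n => a) =
      toPowerOne (X.ordinary.obj (power n a)) ≫ Pi.lift (fun i => X.reprMap
        (Pi.π (fun _ : Fin 1 => power n a) 0 ≫ Pi.π (fun _ : Fin n => a) i)) := by
    rw [power_comp_lift]
    rfl
  rw [h, Category.assoc, ← X.reprMap_lift_comp, Category.comp_id, ← power_comp_lift,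
    power_lift_proj, Category.comp_id, X.reprMap_π]
  exact toPowerOne_proj _

theorem FSetFunctor.reprMap_id_comp_piComparison (X : FSetFunctor (reprCat B) (reprCat C))
    {n : ℕ} {a : B} :
    X.reprMap (𝟙 (power n a)) ≫ piComparison X.ordinary (fun _ : Fin n => a) = 𝟙 _ := by
  apply Pi.hom_ext; intro i
  rw [Category.assoc, piComparison_comp_π, X.reprMap_id_comp_ordinary_map, X.reprMap_π]
  exact (Category.id_comp _).symm

instance FSetFunctor.isIso_piComparison_ordinary (X : FSetFunctor (reprCat B) (reprCat C))
    (n : ℕ) (a : B) : IsIso (piComparison X.ordinary (fun _ : Fin n => a)) :=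
  ⟨X.reprMap (𝟙 (power n a)), X.piComparison_ordinary, X.reprMap_id_comp_piComparison⟩

instance FSetFunctor.preservesFinitePowers_ordinary (X : FSetFunctor (reprCat B) (reprCat C)) :
    PreservesFinitePowers X.ordinary where
  preserves n a := PreservesProduct.of_iso_comparison X.ordinary (fun _ : Fin n => a)

theorem FSetFunctor.reprMap_eq (X : FSetFunctor (reprCat B) (reprCat C)) {n : ℕ} {a b : B}
    (f : power n a ⟶ b) :
    X.reprMap f = inv (piComparison X.ordinary (fun _ : Fin n => a)) ≫ X.ordinary.map f := by
  rw [← X.reprMap_id_comp_ordinary_map]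
  congr 1
  exact IsIso.eq_inv_of_hom_inv_id X.piComparison_ordinary

/-- Every `[𝓕, Set]`-functor `R B → R C` is of the form `R G`. -/
theorem FSetFunctor.reprFunctor_ordinary (X : FSetFunctor (reprCat B) (reprCat C)) :
    reprFunctor X.ordinary = X := by
  have h : ∀ (n : ℕ) (a b : B) (f : power n a ⟶ b),
      inv (piComparison X.ordinary (fun _ : Fin n => a)) ≫ X.ordinary.map f = X.reprMap f :=
    fun n a b f => (X.reprMap_eq f).symm
  cases X with
  | mk obj map map_proj map_comp =>
    -- Passing to the ordinary functor does not change objects, so only the actions on homs need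
    -- comparing.
    refine (FSetFunctor.mk.injEq _ _ _ _ _ _ _ _).mpr ⟨rfl, heq_of_eq ?_⟩
    funext n a b f
    exact h n a b f

end Repr

/-! ## Power families -/

section PowerFamily

variable {B : Type v₁} [Category.{w₁} B] {E : Type v₂} [Category.{w₂} E]
  {C : Type v₃} [Category.{w₃} C]

/-- A family of maps `E(G a, b)ᵏ → C(H a, Q)`, natural in `a`. -/
@[ext]
structure PowerFamily (G : B ⥤ E) (H : B ⥤ C) (b : E) (k : ℕ) (Q : C) where
  app : ∀ a : B, (Fin k → (G.obj a ⟶ b)) → (H.obj a ⟶ Q)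
  naturality : ∀ {a a' : B} (f : a ⟶ a') (w : Fin k → (G.obj a' ⟶ b)),
    app a (fun j => G.map f ≫ w j) = H.map f ≫ app a' w

variable {G : B ⥤ E} {H : B ⥤ C} {b : E}

/-- The component of a cocone on `G ↓ b` at a map `G a ⟶ b`. -/
def costructuredLeg (c : Cocone (CostructuredArrow.proj G b ⋙ H)) {a : B} (w : G.obj a ⟶ b) :
    H.obj a ⟶ c.pt :=
  c.ι.app (CostructuredArrow.mk w)

theorem map_comp_costructuredLeg (c : Cocone (CostructuredArrow.proj G b ⋙ H)) {a a' : B}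
    (f : a ⟶ a') (w : G.obj a' ⟶ b) :
    H.map f ≫ costructuredLeg c w = costructuredLeg c (G.map f ≫ w) :=
  c.w (CostructuredArrow.homMk f : CostructuredArrow.mk (G.map f ≫ w) ⟶ CostructuredArrow.mk w)

variable [HasFinitePowers C]

/-- The power family `(w₁, …, w_k) ↦ (i w₁, …, i w_k) ≫ g` determined by `g : Zᵏ ⟶ Q`, for a
cocone `i` with vertex `Z`. -/
noncomputable def PowerFamily.ofHom (c : Cocone (CostructuredArrow.proj G b ⋙ H)) (k : ℕ) (Q : C)
    (g : power k c.pt ⟶ Q) : PowerFamily G H b k Q where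
  app _ w := Pi.lift (fun j => costructuredLeg c (w j)) ≫ g
  naturality f w := by
    rw [← Category.assoc, power_comp_lift]
    simp only [map_comp_costructuredLeg]

/-- The powers of the vertex of the cocone represent power families. -/
def IsPowerColimit (c : Cocone (CostructuredArrow.proj G b ⋙ H)) : Prop :=
  ∀ (k : ℕ) (Q : C), Function.Bijective (PowerFamily.ofHom c k Q)

theorem IsPowerColimit.hom_ext {c : Cocone (CostructuredArrow.proj G b ⋙ H)}
    (hc : IsPowerColimit c) {k : ℕ} {Q : C} {g g' : power k c.pt ⟶ Q}
    (h : ∀ (a : B) (w : Fin k → (G.obj a ⟶ b)),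
      Pi.lift (fun j => costructuredLeg c (w j)) ≫ g =
        Pi.lift (fun j => costructuredLeg c (w j)) ≫ g') : g = g' :=
  (hc k Q).1 (PowerFamily.ext (funext fun a => funext fun w => h a w))

theorem IsPowerColimit.exists_desc {c : Cocone (CostructuredArrow.proj G b ⋙ H)}
    (hc : IsPowerColimit c) {k : ℕ} {Q : C} (φ : PowerFamily G H b k Q) :
    ∃ g : power k c.pt ⟶ Q, ∀ (a : B) (w : Fin k → (G.obj a ⟶ b)),
      Pi.lift (fun j => costructuredLeg c (w j)) ≫ g = φ.app a w := by
  obtain ⟨g, hg⟩ := (hc k Q).2 φ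
  exact ⟨g, fun a w => congrFun (congrFun (congrArg PowerFamily.app hg) a) w⟩

theorem isPowerColimit_of_existsUnique {c : Cocone (CostructuredArrow.proj G b ⋙ H)}
    (h : ∀ (k : ℕ) (Q : C) (φ : PowerFamily G H b k Q), ∃! g : power k c.pt ⟶ Q,
      ∀ (a : B) (w : Fin k → (G.obj a ⟶ b)),
        Pi.lift (fun j => costructuredLeg c (w j)) ≫ g = φ.app a w) : IsPowerColimit c := by
  intro k Q
  rw [Function.bijective_iff_existsUnique]
  intro φ
  obtain ⟨g, hg, hu⟩ := h k Q φ
  exact ⟨g, PowerFamily.ext (funext fun a => funext fun w => hg a w),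
    fun g' hg' => hu g' fun a w => congrFun (congrFun (congrArg PowerFamily.app hg') a) w⟩

/-- If powers of the vertex represent power families, then the cocone is colimiting. -/
theorem IsPowerColimit.isColimit {c : Cocone (CostructuredArrow.proj G b ⋙ H)}
    (hc : IsPowerColimit c) : Nonempty (IsColimit c) := by
  refine ⟨IsColimit.ofExistsUnique fun s => ?_⟩
  -- A cocone on `G ↓ b` is a power family of exponent 1, up to `Z¹ ≅ Z`.
  let φ : PowerFamily G H b 1 s.pt :=
    { app := fun a w => costructuredLeg s (w 0)
      naturality := fun f w => (map_comp_costructuredLeg s f (w 0)).symm }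
  obtain ⟨g, hg⟩ := hc.exists_desc φ
  refine ⟨toPowerOne c.pt ≫ g, fun x => ?_, fun d hd => ?_⟩
  · rw [← Category.assoc, comp_toPowerOne]
    exact hg x.left (fun _ => x.hom)
  · have e : Pi.π (fun _ : Fin 1 => c.pt) 0 ≫ d = g := by
      refine hc.hom_ext fun a w => ?_
      rw [hg, Pi.lift_π_assoc]
      exact hd (CostructuredArrow.mk (w 0))
    rw [← e, ← Category.assoc, toPowerOne_proj, Category.id_comp]

/-- For a pointwise Kan extension which preserves finite powers, the powers of its values
represent power families. -/
theorem isPowerColimit_coconeAt [HasFinitePowers E] {L : E ⥤ C} [PreservesFinitePowers L]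
    {α : H ⟶ G ⋙ L}
    (h : (Functor.LeftExtension.mk L α).IsPointwiseLeftKanExtension) (b : E) :
    IsPowerColimit ((Functor.LeftExtension.mk L α).coconeAt b) := by
  have lift : ∀ {k : ℕ} {a : B} (w : Fin k → (G.obj a ⟶ b)),
      Pi.lift (f := fun _ : Fin k => L.obj b) (fun j => α.app a ≫ L.map (w j)) =
        α.app a ≫ L.map (Pi.lift w) ≫ piComparison L (fun _ : Fin k => b) := by
    intro k a w
    apply Pi.hom_ext; intro i
    simp
  refine isPowerColimit_of_existsUnique fun k Q φ => ?_
  change ∃! g : power k (L.obj b) ⟶ Q, ∀ (a : B) (w : Fin k → (G.obj a ⟶ b)),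
    Pi.lift (f := fun _ : Fin k => L.obj b) (fun j => α.app a ≫ L.map (w j)) ≫ g = φ.app a w
  have : IsIso (piComparison L (fun _ : Fin k => b)) := inferInstance
  -- Maps `G a ⟶ bᵏ` are `k`-tuples of maps `G a ⟶ b`, so `φ` is a cocone on `G ↓ bᵏ`. It factors
  -- through `L(bᵏ)`, and the comparison isomorphism carries the factorization to `(L b)ᵏ`.
  let s : Cocone (CostructuredArrow.proj G (power k b) ⋙ H) :=
    { pt := Q
      ι :=
        { app := fun x => φ.app x.left (fun j => x.hom ≫ Pi.π _ j)
          naturality := fun x y f => by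
            have := φ.naturality f.left (fun j => y.hom ≫ Pi.π (fun _ : Fin k => b) j)
            simp only [← Category.assoc, CostructuredArrow.w] at this
            refine this.symm.trans (Category.comp_id _).symm } }
  obtain ⟨d, hs, hd⟩ : ∃ d : L.obj (power k b) ⟶ Q,
      (∀ (a : B) (u : G.obj a ⟶ power k b),
        α.app a ≫ L.map u ≫ d = φ.app a (fun j => u ≫ Pi.π _ j)) ∧
      ∀ d' : L.obj (power k b) ⟶ Q, (∀ (a : B) (u : G.obj a ⟶ power k b),
        α.app a ≫ L.map u ≫ d' = φ.app a (fun j => u ≫ Pi.π _ j)) → d' = d :=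
    ⟨(h (power k b)).desc s,
      fun a u => (Category.assoc _ _ _).symm.trans
        ((h (power k b)).fac s (CostructuredArrow.mk u)),
      fun d' hd' => (h (power k b)).uniq s d' fun x =>
        (Category.assoc _ _ _).trans (hd' x.left x.hom)⟩
  refine ⟨inv (piComparison L (fun _ : Fin k => b)) ≫ d, ?_, ?_⟩
  · intro a w
    have e := hs a (Pi.lift w)
    simp only [Pi.lift_π] at e
    rw [lift, ← e]
    simp only [Category.assoc]
    rw [IsIso.hom_inv_id_assoc]
  · intro g hg
    rw [IsIso.eq_inv_comp]
    refine hd _ fun a u => ?_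
    have e := hg a (fun j => u ≫ Pi.π (fun _ : Fin k => b) j)
    rw [lift, ← power_comp_lift, power_lift_proj, Category.comp_id] at e
    refine Eq.trans ?_ e
    simp only [Category.assoc]

end PowerFamily

/-! ## Enriched weighted colimits over `R B` -/

section ReprWeighted

variable {B : Type v₁} [Category.{w₁} B] [HasFinitePowers B]
  {E : Type v₂} [Category.{w₂} E] [HasFinitePowers E]
  {C : Type v₃} [Category.{w₃} C] [HasFinitePowers C]

theorem piComparison_inv_map_π (G : B ⥤ C) [PreservesFinitePowers G] {n : ℕ} {a : B}
    (i : Fin n) :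
    inv (piComparison G (fun _ : Fin n => a)) ≫ G.map (Pi.π (fun _ : Fin n => a) i) =
      Pi.π (fun _ : Fin n => G.obj a) i := by
  simp

theorem piComparison_comp_lift (G : B ⥤ C) [PreservesFinitePowers G] {m n : ℕ} {a a' : B}
    (f : Fin m → (power n a' ⟶ a)) :
    piComparison G (fun _ : Fin n => a') ≫
        Pi.lift (f := fun _ : Fin m => G.obj a)
          (fun i => inv (piComparison G (fun _ : Fin n => a')) ≫ G.map (f i)) =
      G.map (Pi.lift f) ≫ piComparison G (fun _ : Fin m => a) := by
  apply Pi.hom_ext; intro i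
  simp

variable {G : B ⥤ E} [PreservesFinitePowers G] {H : B ⥤ C} [PreservesFinitePowers H] {b : E}

/-- The natural transformation of powers of presheaves underlying an element of
`𝓟(RB)(E(RG –, b), C(RH –, Q))`, with all its arguments in the ordinary categories. -/
def reprHomApp {k : ℕ} {Q : C}
    (ψ : FSetPresheaf.Hom k ((reprFunctor G).homPresheaf (B := reprCat E) b)
      ((reprFunctor H).homPresheaf (B := reprCat C) Q)) (n : ℕ) (a : B)
    (w : Fin k → (power n (G.obj a) ⟶ b)) : power n (H.obj a) ⟶ Q :=
  ψ.app (n := n) (X := a) w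

theorem reprHomApp_act {k : ℕ} {Q : C}
    (ψ : FSetPresheaf.Hom k ((reprFunctor G).homPresheaf (B := reprCat E) b)
      ((reprFunctor H).homPresheaf (B := reprCat C) Q)) {m n : ℕ} {a a' : B}
    (w : Fin k → (power m (G.obj a) ⟶ b)) (f : Fin m → (power n a' ⟶ a)) :
    reprHomApp ψ n a' (fun j => Pi.lift (f := fun _ : Fin m => G.obj a)
        (fun i => inv (piComparison G (fun _ : Fin n => a')) ≫ G.map (f i)) ≫ w j) =
      Pi.lift (f := fun _ : Fin m => H.obj a)
        (fun i => inv (piComparison H (fun _ : Fin n => a')) ≫ H.map (f i)) ≫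
          reprHomApp ψ m a w :=
  ψ.app_act (X := a) (Y := a') w f

/-- The tuple `w` is the action of `𝟙 (aⁿ)`, as an `n`-ary element from `a` to `aⁿ`, on a tuple of
unary elements at `aⁿ`. Compatibility with this action shows that the unary components determine all
others. -/
theorem reprHomApp_eq {k : ℕ} {Q : C}
    (ψ : FSetPresheaf.Hom k ((reprFunctor G).homPresheaf (B := reprCat E) b)
      ((reprFunctor H).homPresheaf (B := reprCat C) Q)) (n : ℕ) (a : B)
    (w : Fin k → (power n (G.obj a) ⟶ b)) :
    reprHomApp ψ n a w = inv (piComparison H (fun _ : Fin n => a)) ≫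
      toPowerOne (H.obj (power n a)) ≫ reprHomApp ψ 1 (power n a)
        (fun j => Pi.π (fun _ : Fin 1 => G.obj (power n a)) 0 ≫
          piComparison G (fun _ : Fin n => a) ≫ w j) := by
  have h := reprHomApp_act ψ (m := 1) (n := n) (a := power n a) (a' := a)
    (fun j => Pi.π (fun _ : Fin 1 => G.obj (power n a)) 0 ≫
          piComparison G (fun _ : Fin n => a) ≫ w j) (fun _ => 𝟙 _)
  simp only [CategoryTheory.Functor.map_id, Category.comp_id, Pi.lift_π_assoc,
    IsIso.inv_hom_id_assoc] at h
  rw [h, ← comp_toPowerOne, Category.assoc]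

theorem map_comp_toPowerOne_reprHomApp {k : ℕ} {Q : C}
    (ψ : FSetPresheaf.Hom k ((reprFunctor G).homPresheaf (B := reprCat E) b)
      ((reprFunctor H).homPresheaf (B := reprCat C) Q)) {a a' : B} (f : a ⟶ a')
    (w : Fin k → (G.obj a' ⟶ b)) :
    toPowerOne (H.obj a) ≫ reprHomApp ψ 1 a
        (fun j => Pi.π (fun _ : Fin 1 => G.obj a) 0 ≫ G.map f ≫ w j) =
      H.map f ≫ toPowerOne (H.obj a') ≫ reprHomApp ψ 1 a'
        (fun j => Pi.π (fun _ : Fin 1 => G.obj a') 0 ≫ w j) := by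
  have h := reprHomApp_act ψ (m := 1) (n := 1) (a := a') (a' := a)
    (fun j => Pi.π (fun _ : Fin 1 => G.obj a') 0 ≫ w j)
    (fun _ => Pi.π (fun _ : Fin 1 => a) 0 ≫ f)
  simp only [Functor.map_comp, Pi.lift_π, ← Category.assoc, piComparison_inv_map_π] at h
  simp only [← Category.assoc, h]
  rw [power_comp_lift]
  simp only [← Category.assoc, toPowerOne_proj, Category.id_comp]
  rw [comp_toPowerOne]

/-- Elements of `𝓟(RB)(E(RG –, b), C(RH –, Q))` are the same as power families. -/
noncomputable def reprHomEquiv (k : ℕ) (Q : C) :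
    FSetPresheaf.Hom k ((reprFunctor G).homPresheaf (B := reprCat E) b)
      ((reprFunctor H).homPresheaf (B := reprCat C) Q) ≃ PowerFamily G H b k Q where
  toFun ψ :=
    { app := fun a w => toPowerOne (H.obj a) ≫ reprHomApp ψ 1 a
        (fun j => Pi.π (fun _ : Fin 1 => G.obj a) 0 ≫ w j)
      naturality := map_comp_toPowerOne_reprHomApp ψ }
  invFun φ :=
    -- The `n`-ary component at `a` is the value of `φ` at `aⁿ`, as `reprHomApp_eq` forces.
    { app := fun {n} {a : B} (w : Fin k → (power n (G.obj a) ⟶ b)) =>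
        (inv (piComparison H (fun _ : Fin n => a)) ≫ φ.app (power n a)
          (fun j => piComparison G (fun _ : Fin n => a) ≫ w j) : power n (H.obj a) ⟶ Q)
      app_act := fun {m} {n} {a a' : B} (w : Fin k → (power m (G.obj a) ⟶ b))
          (f : Fin m → (power n a' ⟶ a)) => by
        change inv (piComparison H (fun _ : Fin n => a')) ≫ φ.app (power n a')
            (fun j => piComparison G (fun _ : Fin n => a') ≫
              Pi.lift (f := fun _ : Fin m => G.obj a)
                (fun i => inv (piComparison G (fun _ : Fin n => a')) ≫ G.map (f i)) ≫ w j) =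
          Pi.lift (f := fun _ : Fin m => H.obj a)
            (fun i => inv (piComparison H (fun _ : Fin n => a')) ≫ H.map (f i)) ≫
            inv (piComparison H (fun _ : Fin m => a)) ≫ φ.app (power m a)
              (fun j => piComparison G (fun _ : Fin m => a) ≫ w j)
        -- Through the comparisons, acting by the tuple `f` is precomposition with the images of the
        -- single map `Pi.lift f : a'ⁿ ⟶ aᵐ`; what remains is naturality of `φ` at that map.
        rw [IsIso.inv_comp_eq, ← Category.assoc, piComparison_comp_lift]
        have h : ∀ j, piComparison G (fun _ : Fin n => a') ≫
              Pi.lift (f := fun _ : Fin m => G.obj a)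
                (fun i => inv (piComparison G (fun _ : Fin n => a')) ≫ G.map (f i)) ≫ w j =
              G.map (Pi.lift f) ≫ piComparison G (fun _ : Fin m => a) ≫ w j := by
          intro j
          rw [← Category.assoc, piComparison_comp_lift, Category.assoc]
        simp only [h]
        rw [φ.naturality]
        simp only [Category.assoc, IsIso.hom_inv_id_assoc] }
  left_inv ψ := by
    apply FSetPresheaf.Hom.ext
    funext n a w
    exact (reprHomApp_eq ψ n a w).symm
  right_inv φ := by
    apply PowerFamily.ext
    funext a w
    change toPowerOne (H.obj a) ≫ inv (piComparison H (fun _ : Fin 1 => a)) ≫ φ.app (power 1 a)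
          (fun j => piComparison G (fun _ : Fin 1 => a) ≫
            Pi.π (fun _ : Fin 1 => G.obj a) 0 ≫ w j) = φ.app a w
    have h : ∀ j, piComparison G (fun _ : Fin 1 => a) ≫ Pi.π (fun _ : Fin 1 => G.obj a) 0 ≫ w j =
        G.map (Pi.π (fun _ : Fin 1 => a) 0) ≫ w j := by
      intro j
      rw [← Category.assoc, piComparison_comp_π]
    simp only [h]
    rw [φ.naturality]
    simp only [← Category.assoc]
    rw [Category.assoc (toPowerOne _), piComparison_inv_map_π, toPowerOne_proj, Category.id_comp]

/-- A map of presheaves `E(RG –, b) → C(RH –, Z)` exhibits `Z` as an enriched weighted colimit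
iff the powers of `Z` represent power families. -/
theorem isWeightedColimit_repr_iff (c : Cocone (CostructuredArrow.proj G b ⋙ H))
    (i : ((reprFunctor G).homPresheaf (B := reprCat E) b).Map
      ((reprFunctor H).homPresheaf (B := reprCat C) c.pt))
    (hi : ∀ (a : B) (w : G.obj a ⟶ b), costructuredLeg c w = toPowerOne (H.obj a) ≫
      (show power 1 (H.obj a) ⟶ c.pt from
        i.app (n := 1) (X := a) (Pi.π (fun _ : Fin 1 => G.obj a) 0 ≫ w))) :
    IsWeightedColimit i ↔ IsPowerColimit c := by
  -- The two comparison maps differ by the bijection `reprHomEquiv`. That bijection reads off unary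
  -- components, so `hi` is needed only for unary elements.
  have e : ∀ (Q : C) (k : ℕ), PowerFamily.ofHom c k Q =
      reprHomEquiv (G := G) (H := H) (b := b) k Q ∘ weightedComparison i Q k := by
    intro Q k
    funext g
    apply PowerFamily.ext
    funext a w
    let l (w₀ : G.obj a ⟶ b) : power 1 (H.obj a) ⟶ c.pt :=
      i.app (n := 1) (X := a) (Pi.π (fun _ : Fin 1 => G.obj a) 0 ≫ w₀)
    have hl : ∀ w₀, costructuredLeg c w₀ = toPowerOne (H.obj a) ≫ l w₀ := hi a
    change Pi.lift (fun j => costructuredLeg c (w j)) ≫ g =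
      toPowerOne (H.obj a) ≫ Pi.lift (fun j => l (w j)) ≫ g
    simp only [hl, ← power_comp_lift, Category.assoc]
  constructor
  · intro h k Q
    rw [e]
    exact (reprHomEquiv k Q).bijective.comp (h Q k)
  · intro h (Q : C) k
    exact (Equiv.comp_bijective _ (reprHomEquiv k Q)).1
      ((congrArg Function.Bijective (e Q k)).mp (h k Q))

end ReprWeighted

/-! ## Kan extensions along `R G` -/

section ReprLan

variable {B : Type v₁} [Category.{w₁} B] [HasFinitePowers B]
  {E : Type v₂} [Category.{w₂} E] [HasFinitePowers E]
  {C : Type v₃} [Category.{w₃} C] [HasFinitePowers C]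
  {G : B ⥤ E} [PreservesFinitePowers G] {H : B ⥤ C} [PreservesFinitePowers H]
  {L : E ⥤ C} [PreservesFinitePowers L]

/-- The components of an `[𝓕, Set]`-transformation `R H ⇒ (R L)(R G)`. -/
def reprTransApp (α : FSetTrans (reprFunctor H) ((reprFunctor G).then (reprFunctor L))) (a : B) :
    power 1 (H.obj a) ⟶ L.obj (G.obj a) :=
  α.app a

theorem lift_lift_π {X Y : C} (f : power 1 X ⟶ Y) :
    Pi.lift (f := fun _ : Fin 1 => Y) (fun i : Fin 1 =>
      Pi.lift (f := fun _ : Fin 1 => X) (fun _ => Pi.π (fun _ : Fin 1 => X) i) ≫ f) =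
      Pi.lift (fun _ => f) := by
  congr 1
  funext i
  have h : Pi.lift (f := fun _ : Fin 1 => X) (fun _ => Pi.π (fun _ : Fin 1 => X) i) = 𝟙 _ := by
    apply Pi.hom_ext; intro j
    rw [Subsingleton.elim j i]; simp
  rw [h, Category.id_comp]

/-- The ordinary natural transformation `H ⇒ L G` underlying an `[𝓕, Set]`-transformation. -/
noncomputable def reprTransOrdinary
    (α : FSetTrans (reprFunctor H) ((reprFunctor G).then (reprFunctor L))) : H ⟶ G ⋙ L where
  app a := toPowerOne (H.obj a) ≫ reprTransApp α a
  naturality a a' f := by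
    have h : Pi.lift (f := fun _ : Fin 1 => H.obj a')
          (fun _ => inv (piComparison H (fun _ : Fin 1 => a)) ≫
            H.map (Pi.π (fun _ : Fin 1 => a) 0 ≫ f)) ≫ reprTransApp α a' =
        Pi.lift (f := fun _ : Fin 1 => L.obj (G.obj a)) (fun i : Fin 1 =>
          Pi.lift (f := fun _ : Fin 1 => H.obj a) (fun _ => Pi.π (fun _ : Fin 1 => H.obj a) i) ≫
            reprTransApp α a) ≫ inv (piComparison L (fun _ : Fin 1 => G.obj a)) ≫
          L.map (inv (piComparison G (fun _ : Fin 1 => a)) ≫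
            G.map (Pi.π (fun _ : Fin 1 => a) 0 ≫ f)) :=
      α.naturality (X := a) (Y := a') (n := 1) (Pi.π (fun _ : Fin 1 => a) 0 ≫ f)
    have hG : inv (piComparison G (fun _ : Fin 1 => a)) ≫
            G.map (Pi.π (fun _ : Fin 1 => a) 0 ≫ f) =
        Pi.π (fun _ : Fin 1 => G.obj a) 0 ≫ G.map f := by
      rw [G.map_comp, ← Category.assoc, piComparison_inv_map_π]
    have hL : inv (piComparison L (fun _ : Fin 1 => G.obj a)) ≫
          L.map (Pi.π (fun _ : Fin 1 => G.obj a) 0 ≫ G.map f) =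
        Pi.π (fun _ : Fin 1 => L.obj (G.obj a)) 0 ≫ L.map (G.map f) := by
      rw [L.map_comp, ← Category.assoc, piComparison_inv_map_π]
    have hH : inv (piComparison H (fun _ : Fin 1 => a)) ≫
            H.map (Pi.π (fun _ : Fin 1 => a) 0 ≫ f) =
        Pi.π (fun _ : Fin 1 => H.obj a) 0 ≫ H.map f := by
      rw [H.map_comp, ← Category.assoc, piComparison_inv_map_π]
    rw [hG, hL, hH, lift_lift_π, Pi.lift_π_assoc] at h
    have h' := congrArg (fun t => toPowerOne (H.obj a) ≫ t) h
    simp only [toPowerOne_lift] at h'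
    simp only [← Category.assoc, toPowerOne_proj, Category.id_comp] at h'
    rw [← Category.assoc, comp_toPowerOne]
    exact h'

/-- The `[𝓕, Set]`-transformation `R H ⇒ (R L)(R G)` of a natural transformation `H ⇒ L G`. -/
noncomputable def reprTrans (α : H ⟶ G ⋙ L) :
    FSetTrans (reprFunctor H) ((reprFunctor G).then (reprFunctor L)) where
  app (a : B) := (Pi.π (fun _ : Fin 1 => H.obj a) 0 ≫ α.app a :
    power 1 (H.obj a) ⟶ L.obj (G.obj a))
  naturality {n} {a a' : B} (f : power n a ⟶ a') := by
    change Pi.lift (f := fun _ : Fin 1 => H.obj a')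
          (fun _ => inv (piComparison H (fun _ : Fin n => a)) ≫ H.map f) ≫
            Pi.π (fun _ : Fin 1 => H.obj a') 0 ≫ α.app a' =
        Pi.lift (f := fun _ : Fin n => L.obj (G.obj a)) (fun i : Fin n =>
          Pi.lift (f := fun _ : Fin 1 => H.obj a) (fun _ => Pi.π (fun _ : Fin n => H.obj a) i) ≫
            Pi.π (fun _ : Fin 1 => H.obj a) 0 ≫ α.app a) ≫
          inv (piComparison L (fun _ : Fin n => G.obj a)) ≫
          L.map (inv (piComparison G (fun _ : Fin n => a)) ≫ G.map f)
    -- Naturality at the `n` projections shows that `α` at `aⁿ` is the `n`-th power of `α` at `a`.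
    -- Ordinary naturality therefore already gives enriched naturality.
    have e : α.app (power n a) ≫ L.map (piComparison G (fun _ : Fin n => a)) ≫
        piComparison L (fun _ : Fin n => G.obj a) =
        piComparison H (fun _ : Fin n => a) ≫ Pi.lift (f := fun _ : Fin n => L.obj (G.obj a))
          (fun i => Pi.π (fun _ : Fin n => H.obj a) i ≫ α.app a) := by
      apply Pi.hom_ext; intro i
      have := α.naturality (Pi.π (fun _ : Fin n => a) i)
      simp only [Functor.comp_map] at this
      simp only [Category.assoc, piComparison_comp_π, Pi.lift_π, ← L.map_comp]
      rw [← this, ← Category.assoc, piComparison_comp_π]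
    simp only [Pi.lift_π_assoc, Category.assoc]
    rw [IsIso.inv_comp_eq, ← Category.assoc (piComparison H _), ← e]
    simp only [Category.assoc, IsIso.hom_inv_id_assoc, ← L.map_comp]
    exact α.naturality f

theorem reprTransOrdinary_reprTrans (α : H ⟶ G ⋙ L) : reprTransOrdinary (reprTrans α) = α := by
  ext a
  change toPowerOne (H.obj a) ≫ Pi.π (fun _ : Fin 1 => H.obj a) 0 ≫ α.app a = α.app a
  rw [← Category.assoc, toPowerOne_proj, Category.id_comp]

/-- Both sides are tested at each `b`; what has to be checked is that the unary part of `lanLeg α b`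
is the leg `α ≫ L w` of the cocone at `b`. -/
theorem isLan_repr_iff
    (α : FSetTrans (reprFunctor H) ((reprFunctor G).then (reprFunctor L))) :
    IsLan (reprFunctor G) (reprFunctor H) (reprFunctor L) α ↔
      ∀ b : E, IsPowerColimit ((Functor.LeftExtension.mk L (reprTransOrdinary α)).coconeAt b) := by
  refine forall_congr' fun (b : E) => isWeightedColimit_repr_iff
    ((Functor.LeftExtension.mk L (reprTransOrdinary α)).coconeAt b) (lanLeg α b) fun a w => ?_
  change (toPowerOne (H.obj a) ≫ reprTransApp α a) ≫ L.map w = toPowerOne (H.obj a) ≫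
    Pi.lift (f := fun _ : Fin 1 => L.obj (G.obj a)) (fun i : Fin 1 =>
      Pi.lift (f := fun _ : Fin 1 => H.obj a) (fun _ => Pi.π (fun _ : Fin 1 => H.obj a) i) ≫
        reprTransApp α a) ≫ inv (piComparison L (fun _ : Fin 1 => G.obj a)) ≫
      L.map (Pi.π (fun _ : Fin 1 => G.obj a) 0 ≫ w)
  rw [lift_lift_π, L.map_comp, ← Category.assoc (inv _), piComparison_inv_map_π,
    Pi.lift_π_assoc, Category.assoc]

/-- The enriched Kan extension of `R H` along `R G` exists iff the unenriched Kan extension of `H`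
along `G` exists and preserves finite powers. -/
theorem hasLan_repr_iff :
    HasLan (reprFunctor G) (reprFunctor H) ↔ ∃ (L : E ⥤ C) (α : H ⟶ G ⋙ L),
      Nonempty (Functor.LeftExtension.mk L α).IsPointwiseLeftKanExtension ∧
        PreservesFinitePowers L := by
  constructor
  · rintro ⟨X, α, h⟩
    -- The enriched extension is itself of the form `R L`, with `L` preserving powers.
    obtain ⟨L, hL, rfl⟩ : ∃ (L : E ⥤ C) (_ : PreservesFinitePowers L), reprFunctor L = X :=
      ⟨X.ordinary, inferInstance, X.reprFunctor_ordinary⟩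
    exact ⟨L, reprTransOrdinary α,
      ⟨fun b => ((isLan_repr_iff α).1 h b).isColimit.some⟩, hL⟩
  · rintro ⟨L, α, ⟨h⟩, hL⟩
    refine ⟨reprFunctor L, reprTrans α, (isLan_repr_iff _).2 fun b => ?_⟩
    rw [reprTransOrdinary_reprTrans]
    exact isPowerColimit_coconeAt h b

end ReprLan

/-! ## Coordinates in Lawvere theories -/

section Coordinates

variable {S : CategoryTheory.Monad (Type u)}

/-- The `i`-th coordinate `Aⁿ ⟶ A` of an object of the Lawvere theory. -/
def LawvereTheory.coord (a : LawvereTheory S) (i : Fin a.arity) : a ⟶ LawvereTheory.gen S :=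
  (⟨fun _ => Ops.var S i⟩ : LawvereTheory.Hom _ _)

/-- The map `Aⁿ ⟶ A` given by an operation. -/
def LawvereTheory.opHom {n : ℕ} (f : Ops S n) : (⟨n⟩ : LawvereTheory S) ⟶ LawvereTheory.gen S :=
  (⟨fun _ => f⟩ : LawvereTheory.Hom _ _)

/-- The operation given by a map `Aⁿ ⟶ A`. -/
def LawvereTheory.homOp {a : LawvereTheory S} (f : a ⟶ LawvereTheory.gen S) : Ops S a.arity :=
  LawvereTheory.Hom.ops f 0

theorem LawvereTheory.opHom_homOp {a : LawvereTheory S} (f : a ⟶ LawvereTheory.gen S) :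
    LawvereTheory.opHom (LawvereTheory.homOp f) = f :=
  LawvereTheory.Hom.ext (funext fun j => by rw [Subsingleton.elim j (0 : Fin 1)]; rfl)

theorem LawvereTheory.comp_coord {a b : LawvereTheory S} (f : a ⟶ b) (i : Fin b.arity) :
    f ≫ b.coord i = LawvereTheory.opHom (LawvereTheory.Hom.ops f i) :=
  LawvereTheory.Hom.ext (funext fun _ => Ops.var_subst S _ _)

theorem LawvereTheory.hom_ext {a b : LawvereTheory S} {f g : a ⟶ b}
    (h : ∀ i, f ≫ b.coord i = g ≫ b.coord i) : f = g :=
  LawvereTheory.Hom.ext (funext fun i => by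
    have := h i
    rw [LawvereTheory.comp_coord, LawvereTheory.comp_coord] at this
    exact congrFun (congrArg LawvereTheory.Hom.ops this) 0)

/-- The map into an object of the Lawvere theory with given coordinates. -/
def LawvereTheory.tuple {a b : LawvereTheory S} (f : Fin b.arity → (a ⟶ LawvereTheory.gen S)) :
    a ⟶ b :=
  (⟨fun i => LawvereTheory.homOp (f i)⟩ : LawvereTheory.Hom _ _)

theorem LawvereTheory.tuple_coord {a b : LawvereTheory S}
    (f : Fin b.arity → (a ⟶ LawvereTheory.gen S)) (i : Fin b.arity) :
    LawvereTheory.tuple f ≫ b.coord i = f i := by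
  rw [LawvereTheory.comp_coord]
  exact LawvereTheory.opHom_homOp (f i)

/-- Each object of the Lawvere theory is a power of the distinguished object. -/
def LawvereTheory.isLimitCoord (a : LawvereTheory S) : IsLimit (Fan.mk a a.coord) :=
  Fan.IsLimit.mk _ (fun s => LawvereTheory.tuple s.proj)
    (fun s i => LawvereTheory.tuple_coord s.proj i)
    (fun s _ hm => LawvereTheory.hom_ext fun i =>
      (hm i).trans (LawvereTheory.tuple_coord s.proj i).symm)

variable {C : Type v₁} [Category.{w₁} C]

/-- A functor out of the Lawvere theory presents its values as powers. -/
def PreservesCoordinates (H : LawvereTheory S ⥤ C) : Prop :=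
  ∀ a : LawvereTheory S, Nonempty (IsLimit (Fan.mk (H.obj a) (fun i => H.map (a.coord i))))

theorem PreservesFinitePowers.preservesCoordinates (H : LawvereTheory S ⥤ C)
    [PreservesFinitePowers H] : PreservesCoordinates H := fun a =>
  ⟨isLimitMapConeFanMkEquiv H _ _ (isLimitOfPreserves H a.isLimitCoord)⟩

theorem PreservesCoordinates.hom_ext {H : LawvereTheory S ⥤ C} (hH : PreservesCoordinates H)
    {a : LawvereTheory S} {Y : C} {f g : Y ⟶ H.obj a}
    (h : ∀ i, f ≫ H.map (a.coord i) = g ≫ H.map (a.coord i)) : f = g :=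
  Fan.IsLimit.hom_ext (hH a).some f g h

theorem PreservesCoordinates.exists_lift {H : LawvereTheory S ⥤ C} (hH : PreservesCoordinates H)
    {a : LawvereTheory S} {Y : C} (f : Fin a.arity → (Y ⟶ H.obj (LawvereTheory.gen S))) :
    ∃ g : Y ⟶ H.obj a, ∀ i, g ≫ H.map (a.coord i) = f i :=
  ⟨Fan.IsLimit.lift (hH a).some f, fun i => Fan.IsLimit.fac (hH a).some f i⟩

/-- The projections from a sum of arities. -/
def LawvereTheory.sumProj {ι : Type} (a : ι → LawvereTheory S) {N : ℕ}
    (e : (Σ i, Fin (a i).arity) ≃ Fin N) (i : ι) : (⟨N⟩ : LawvereTheory S) ⟶ a i :=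
  LawvereTheory.tuple fun j => LawvereTheory.coord ⟨N⟩ (e ⟨i, j⟩)

theorem LawvereTheory.sumProj_coord {ι : Type} (a : ι → LawvereTheory S) {N : ℕ}
    (e : (Σ i, Fin (a i).arity) ≃ Fin N) (i : ι) (j : Fin (a i).arity) :
    LawvereTheory.sumProj a e i ≫ (a i).coord j = LawvereTheory.coord ⟨N⟩ (e ⟨i, j⟩) :=
  LawvereTheory.tuple_coord _ _

/-- Functors presenting their values as powers preserve products given by sums of arities. -/
theorem PreservesCoordinates.isLimit_sumProj {H : LawvereTheory S ⥤ C}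
    (hH : PreservesCoordinates H) {ι : Type} (a : ι → LawvereTheory S) {N : ℕ}
    (e : (Σ i, Fin (a i).arity) ≃ Fin N) :
    Nonempty (IsLimit (Fan.mk (f := fun i => H.obj (a i)) (H.obj ⟨N⟩)
      (fun i => H.map (LawvereTheory.sumProj a e i)))) := by
  have hl : ∀ s : Fan (fun i => H.obj (a i)), ∃ g : s.pt ⟶ H.obj ⟨N⟩, ∀ l : Fin N,
      g ≫ H.map (LawvereTheory.coord ⟨N⟩ l) =
        s.proj (e.symm l).1 ≫ H.map ((a (e.symm l).1).coord (e.symm l).2) :=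
    fun s => hH.exists_lift (a := ⟨N⟩) _
  choose g hg using hl
  have hg' : ∀ (s : Fan (fun i => H.obj (a i))) (i : ι) (j : Fin (a i).arity),
      g s ≫ H.map (LawvereTheory.coord ⟨N⟩ (e ⟨i, j⟩)) = s.proj i ≫ H.map ((a i).coord j) := by
    intro s i j
    have := hg s (e ⟨i, j⟩)
    rwa [Equiv.symm_apply_apply] at this
  refine ⟨Fan.IsLimit.mk _ g (fun s i => hH.hom_ext fun j => ?_)
    (fun s m hm => hH.hom_ext fun l => ?_)⟩
  · change (g s ≫ H.map (LawvereTheory.sumProj a e i)) ≫ _ = _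
    rw [Category.assoc, ← H.map_comp, LawvereTheory.sumProj_coord, hg']
  · obtain ⟨⟨i, j⟩, rfl⟩ := e.surjective l
    refine Eq.trans ?_ (hg' s i j).symm
    rw [← LawvereTheory.sumProj_coord, H.map_comp, ← Category.assoc]
    exact congrArg (· ≫ _) (hm i)

/-- The `n`-th power of `Aᵐ` is `Aⁿᵐ`, a product given by a sum of arities, so it is enough that
values are powers of the value at `A`. -/
theorem PreservesCoordinates.preservesFinitePowers {H : LawvereTheory S ⥤ C}
    (hH : PreservesCoordinates H) : PreservesFinitePowers H where
  preserves n a := by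
    refine preservesLimit_of_preserves_limit_cone (LawvereTheory.isLimitFan n a)
      ((isLimitMapConeFanMkEquiv H _ _).symm ?_)
    exact (hH.isLimit_sumProj (fun _ : Fin n => a)
      ((Equiv.sigmaEquivProd (Fin n) (Fin a.arity)).trans finProdFinEquiv)).some

variable [HasFinitePowers C]

/-- The comparison from the value at `Aⁿ` to the power of the value at `A`. -/
noncomputable def coordComparison (H : LawvereTheory S ⥤ C) (a : LawvereTheory S) :
    H.obj a ⟶ power a.arity (H.obj (LawvereTheory.gen S)) :=
  Pi.lift (fun i => H.map (a.coord i))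

theorem PreservesCoordinates.isIso_coordComparison {H : LawvereTheory S ⥤ C}
    (hH : PreservesCoordinates H) (a : LawvereTheory S) : IsIso (coordComparison H a) := by
  obtain ⟨g, hg⟩ := hH.exists_lift (a := a)
    (fun i => Pi.π (fun _ : Fin a.arity => H.obj (LawvereTheory.gen S)) i)
  refine ⟨g, hH.hom_ext fun i => ?_, Pi.hom_ext _ _ fun i => ?_⟩
  · rw [Category.assoc, hg, coordComparison, Pi.lift_π, Category.id_comp]
  · rw [Category.assoc, coordComparison, Pi.lift_π, hg, Category.id_comp]

instance isIso_coordComparison (H : LawvereTheory S ⥤ C) [PreservesFinitePowers H]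
    (a : LawvereTheory S) : IsIso (coordComparison H a) :=
  (PreservesFinitePowers.preservesCoordinates H).isIso_coordComparison a

/-- The chosen power of `A` need not be the object of arity `n`. The tuple of coordinates cancels
the canonical map between them that enters `ofOp`. -/
theorem lift_coord_comp_ofOp {n : ℕ} (f : Ops S n) :
    Pi.lift (LawvereTheory.coord ⟨n⟩) ≫ LawvereTheory.ofOp S f = LawvereTheory.opHom f := by
  have h : Pi.lift (LawvereTheory.coord (S := S) ⟨n⟩) ≫
      (⟨fun i => LawvereTheory.Hom.ops (Pi.π (fun _ : Fin n => LawvereTheory.gen S) i) 0⟩ :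
      power n (LawvereTheory.gen S) ⟶ (⟨n⟩ : LawvereTheory S)) = 𝟙 _ := by
    refine LawvereTheory.Hom.ext (funext fun i => ?_)
    exact congrFun (congrArg LawvereTheory.Hom.ops
      (Pi.lift_π (LawvereTheory.coord (S := S) ⟨n⟩) i)) 0
  rw [LawvereTheory.ofOp, ← Category.assoc, h, Category.id_comp]
  rfl

/-- Reconciles two descriptions of `(H A)ⁿ`: through the object of arity `n` and through the chosen
power of `A`. -/
theorem coordComparison_comp_ofOp (H : LawvereTheory S ⥤ C) [PreservesFinitePowers H] {n : ℕ}
    (f : Ops S n) :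
    coordComparison H ⟨n⟩ ≫ inv (piComparison H (fun _ : Fin n => LawvereTheory.gen S)) ≫
      H.map (LawvereTheory.ofOp S f) = H.map (LawvereTheory.opHom f) := by
  have h : coordComparison H ⟨n⟩ = H.map (Pi.lift (LawvereTheory.coord ⟨n⟩)) ≫
      piComparison H (fun _ : Fin n => LawvereTheory.gen S) := by
    apply Pi.hom_ext; intro i
    simp [coordComparison]
  rw [h, Category.assoc, IsIso.hom_inv_id_assoc, ← H.map_comp, lift_coord_comp_ofOp]

theorem coordComparison_comp_lift_ofOp (H : LawvereTheory S ⥤ C) [PreservesFinitePowers H]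
    {a b : LawvereTheory S} (f : a ⟶ b) :
    coordComparison H a ≫ Pi.lift (f := fun _ : Fin b.arity => H.obj (LawvereTheory.gen S))
      (fun i => inv (piComparison H (fun _ : Fin a.arity => LawvereTheory.gen S)) ≫
        H.map (LawvereTheory.ofOp S (LawvereTheory.Hom.ops f i))) =
      H.map f ≫ coordComparison H b := by
  apply Pi.hom_ext; intro i
  rw [Category.assoc, Category.assoc, Pi.lift_π, coordComparison_comp_ofOp, coordComparison,
    Pi.lift_π, ← H.map_comp, LawvereTheory.comp_coord]

end Coordinates

/-- This is the compatibility of `η` with `R G` and `Σ F` on homs. After precomposing with an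
isomorphism of coordinates, both sides become the map named by `F f`. -/
theorem reprFunctor_theoryMap_ofOp {S T : CategoryTheory.Monad (Type u)} (F : S ⟶ T) {n : ℕ}
    (f : Ops S n) :
    inv (piComparison (theoryMap F) (fun _ : Fin n => LawvereTheory.gen S)) ≫
      (theoryMap F).map (LawvereTheory.ofOp S f) = LawvereTheory.ofOp T (Ops.map F f) := by
  have h := coordComparison_comp_ofOp (theoryMap F) f
  have h' : coordComparison (theoryMap F) ⟨n⟩ = Pi.lift (LawvereTheory.coord (S := T) ⟨n⟩) := by
    refine congrArg (Pi.lift (f := fun _ : Fin n => LawvereTheory.gen T)) (funext fun i => ?_)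
    exact LawvereTheory.Hom.ext (funext fun _ => Ops.map_var F _)
  refine (cancel_epi (coordComparison (theoryMap F) ⟨n⟩)).1 (h.trans ?_)
  refine (lift_coord_comp_ofOp (Ops.map F f)).symm.trans ?_
  exact congrArg (· ≫ LawvereTheory.ofOp T (Ops.map F f)) h'.symm

/-! ## Enriched weighted colimits over `Σ S` -/

section SigmaWeighted

variable {C : Type v} [Category.{w₁} C] [HasFinitePowers C]
  {S T : CategoryTheory.Monad (Type u)} {F : S ⟶ T}
  {H : LawvereTheory S ⥤ C} [PreservesFinitePowers H]

/-- The presheaf `T` on `Σ S`. -/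
abbrev sigmaPresheaf (F : S ⟶ T) : FSetPresheaf (sigmaCat S) :=
  (sigmaMap F).homPresheaf PUnit.unit

/-- The presheaf `C((H A)ⁿ, Q)` on `Σ S`. -/
noncomputable abbrev sigmaHomPresheaf (H : LawvereTheory S ⥤ C) [PreservesFinitePowers H] (Q : C) :
    FSetPresheaf (sigmaCat S) :=
  ((theoryUnit S).then (reprFunctor H)).homPresheaf (B := reprCat C) Q

/-- The components of an element of `𝓟(ΣS)(T, C(H A, Q))`. -/
def sigmaHomApp {k : ℕ} {Q : C}
    (ψ : FSetPresheaf.Hom k (sigmaPresheaf F) (sigmaHomPresheaf H Q)) {n : ℕ}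
    (w : Fin k → Ops T n) : power n (H.obj (LawvereTheory.gen S)) ⟶ Q :=
  ψ.app (n := n) (X := PUnit.unit) w

theorem sigmaHomApp_act {k : ℕ} {Q : C}
    (ψ : FSetPresheaf.Hom k (sigmaPresheaf F) (sigmaHomPresheaf H Q)) {m n : ℕ}
    (w : Fin k → Ops T m) (f : Fin m → Ops S n) :
    sigmaHomApp ψ (fun j => Ops.subst T (w j) (fun i => Ops.map F (f i))) =
      Pi.lift (f := fun _ : Fin m => H.obj (LawvereTheory.gen S))
        (fun i => inv (piComparison H (fun _ : Fin n => LawvereTheory.gen S)) ≫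
          H.map (LawvereTheory.ofOp S (f i))) ≫ sigmaHomApp ψ w :=
  ψ.app_act (X := PUnit.unit) (Y := PUnit.unit) w f

/-- Elements of `𝓟(ΣS)(T, C(H A, Q))` are the same as power families. -/
noncomputable def sigmaHomEquiv (F : S ⟶ T) (H : LawvereTheory S ⥤ C) [PreservesFinitePowers H]
    (k : ℕ) (Q : C) :
    FSetPresheaf.Hom k (sigmaPresheaf F) (sigmaHomPresheaf H Q) ≃
      PowerFamily (theoryMap F) H (LawvereTheory.gen T) k Q where
  toFun ψ :=
    -- With `n` the arity of `a`, a map to `A` over `a` is an element of `T(n)` and `H a ≅ (H A)ⁿ`.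
    -- The `n`-ary component at the one object of `Σ S` thus serves as the component at `Aⁿ`.
    { app := fun a w => coordComparison H a ≫ sigmaHomApp ψ (fun j => LawvereTheory.homOp (w j))
      naturality := fun {a a'} f w => by
        have h := sigmaHomApp_act ψ (fun j => LawvereTheory.homOp (w j)) (LawvereTheory.Hom.ops f)
        refine (congrArg (coordComparison H a ≫ ·) h).trans ?_
        exact (Category.assoc _ _ _).symm.trans ((congrArg
          (· ≫ sigmaHomApp ψ (fun j => LawvereTheory.homOp (w j)))
            (coordComparison_comp_lift_ofOp H f)).trans (Category.assoc _ _ _)) }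
  invFun φ :=
    { app := fun {n} {_} (w : Fin k → Ops T n) =>
        (inv (coordComparison H ⟨n⟩) ≫ φ.app ⟨n⟩ (fun j => LawvereTheory.opHom (w j)) :
          power n (H.obj (LawvereTheory.gen S)) ⟶ Q)
      app_act := fun {m n} {_ _} (w : Fin k → Ops T m) (f : Fin m → Ops S n) => by
        let f' : (⟨n⟩ : LawvereTheory S) ⟶ ⟨m⟩ := (⟨f⟩ : LawvereTheory.Hom _ _)
        change inv (coordComparison H ⟨n⟩) ≫ φ.app ⟨n⟩
            (fun j => (theoryMap F).map f' ≫ LawvereTheory.opHom (w j)) =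
          Pi.lift (f := fun _ : Fin m => H.obj (LawvereTheory.gen S))
            (fun i => inv (piComparison H (fun _ : Fin n => LawvereTheory.gen S)) ≫
              H.map (LawvereTheory.ofOp S (f i))) ≫
            inv (coordComparison H ⟨m⟩) ≫ φ.app ⟨m⟩ (fun j => LawvereTheory.opHom (w j))
        have h := coordComparison_comp_lift_ofOp H f'
        rw [IsIso.inv_comp_eq]
        refine (φ.naturality f' (fun j => LawvereTheory.opHom (w j))).trans ?_
        refine Eq.trans ?_ (Category.assoc _ _ _)
        refine Eq.trans ?_ (congrArg (· ≫ inv (coordComparison H ⟨m⟩) ≫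
          φ.app ⟨m⟩ (fun j => LawvereTheory.opHom (w j))) h.symm)
        simp only [Category.assoc]
        rw [IsIso.hom_inv_id_assoc] }
  left_inv ψ := by
    apply FSetPresheaf.Hom.ext
    funext n X w
    exact IsIso.inv_hom_id_assoc (coordComparison H ⟨n⟩) (sigmaHomApp ψ w)
  right_inv φ := by
    apply PowerFamily.ext
    funext a w
    refine (IsIso.hom_inv_id_assoc (coordComparison H a) _).trans ?_
    exact congrArg (φ.app a) (funext fun j => LawvereTheory.opHom_homOp (w j))

/-- The components of a map of presheaves `T → C(H A, Z)` on `Σ S`. -/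
def sigmaMapApp {Z : C} (i : (sigmaPresheaf F).Map (sigmaHomPresheaf H Z)) {n : ℕ}
    (w : Ops T n) : power n (H.obj (LawvereTheory.gen S)) ⟶ Z :=
  i.app (n := n) (X := PUnit.unit) w

/-- A map of presheaves `T → C(H A, Z)` exhibits `Z` as an enriched weighted colimit iff the powers
of `Z` represent power families. -/
theorem isWeightedColimit_sigma_iff
    (c : Cocone (CostructuredArrow.proj (theoryMap F) (LawvereTheory.gen T) ⋙ H))
    (i : (sigmaPresheaf F).Map (sigmaHomPresheaf H c.pt))
    (hi : ∀ (a : LawvereTheory S) (w : (theoryMap F).obj a ⟶ LawvereTheory.gen T),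
      costructuredLeg c w = coordComparison H a ≫ sigmaMapApp i (LawvereTheory.homOp w)) :
    IsWeightedColimit i ↔ IsPowerColimit c := by
  have e : ∀ (Q : C) (k : ℕ), PowerFamily.ofHom c k Q =
      sigmaHomEquiv F H k Q ∘ weightedComparison i Q k := by
    intro Q k
    funext g
    apply PowerFamily.ext
    funext a w
    change Pi.lift (fun j => costructuredLeg c (w j)) ≫ g = coordComparison H a ≫
      Pi.lift (fun j => sigmaMapApp i (LawvereTheory.homOp (w j))) ≫ g
    simp only [hi, ← power_comp_lift, Category.assoc]
  constructor
  · intro h k Q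
    rw [e]
    exact (sigmaHomEquiv F H k Q).bijective.comp (h Q k)
  · intro h (Q : C) k
    exact (Equiv.comp_bijective _ (sigmaHomEquiv F H k Q)).1
      ((congrArg Function.Bijective (e Q k)).mp (h k Q))

/-- The cocone corresponding to a map of presheaves `T → C(H A, Z)` on `Σ S`. -/
noncomputable def sigmaCocone {Z : C} (i : (sigmaPresheaf F).Map (sigmaHomPresheaf H Z)) :
    Cocone (CostructuredArrow.proj (theoryMap F) (LawvereTheory.gen T) ⋙ H) where
  pt := Z
  ι :=
    -- The map `i`, viewed as an element of exponent 1, becomes a power family of exponent 1, that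
    -- is, a cocone.
    { app := fun x => (sigmaHomEquiv F H 1 Z
        { app := fun w => i.app (w 0)
          app_act := fun w f => i.app_act (w 0) f }).app x.left (fun _ => x.hom)
      naturality := fun x y f => by
        have h := (sigmaHomEquiv F H 1 Z
          { app := fun w => i.app (w 0)
            app_act := fun w f => i.app_act (w 0) f }).naturality f.left (fun _ => y.hom)
        simp only [CostructuredArrow.w] at h
        exact h.symm.trans (Category.comp_id _).symm }

theorem costructuredLeg_sigmaCocone {Z : C} (i : (sigmaPresheaf F).Map (sigmaHomPresheaf H Z))
    {a : LawvereTheory S} (w : (theoryMap F).obj a ⟶ LawvereTheory.gen T) :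
    costructuredLeg (sigmaCocone i) w =
      coordComparison H a ≫ sigmaMapApp i (LawvereTheory.homOp w) :=
  rfl

/-- If the enriched Kan extension along `Σ F` exists, its value represents power families. -/
theorem exists_isPowerColimit_of_hasLan_sigma
    (h : HasLan (sigmaMap F) ((theoryUnit S).then (reprFunctor H))) :
    ∃ c : Cocone (CostructuredArrow.proj (theoryMap F) (LawvereTheory.gen T) ⋙ H),
      IsPowerColimit c := by
  obtain ⟨L, α, h⟩ := h
  exact ⟨sigmaCocone (Z := L.obj PUnit.unit) (lanLeg α PUnit.unit),
    (isWeightedColimit_sigma_iff _ _ fun a w => costructuredLeg_sigmaCocone _ w).1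
      (h PUnit.unit)⟩

variable {L : LawvereTheory T ⥤ C} [PreservesFinitePowers L]

/-- The restriction of `R α` along the inclusions of `Σ S` and `Σ T`. -/
noncomputable def sigmaTrans (α : H ⟶ theoryMap F ⋙ L) :
    FSetTrans ((theoryUnit S).then (reprFunctor H))
      ((sigmaMap F).then ((theoryUnit T).then (reprFunctor L))) where
  app _ := (reprTrans α).app (LawvereTheory.gen S)
  naturality {n _ _} (f : Ops S n) := by
    refine ((reprTrans α).naturality (X := LawvereTheory.gen S) (Y := LawvereTheory.gen S)
      (LawvereTheory.ofOp S f)).trans ?_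
    exact congrArg (fun t => (reprCat C).comp ((reprFunctor L).map (X := LawvereTheory.gen T)
      (Y := LawvereTheory.gen T) t) _) (reprFunctor_theoryMap_ofOp F f)

/-- If the unenriched Kan extension exists and preserves finite powers, then the enriched Kan
extension along `Σ F` exists. -/
theorem hasLan_sigma {α : H ⟶ theoryMap F ⋙ L}
    (h : (Functor.LeftExtension.mk L α).IsPointwiseLeftKanExtension) :
    HasLan (sigmaMap F) ((theoryUnit S).then (reprFunctor H)) := by
  refine ⟨(theoryUnit T).then (reprFunctor L), sigmaTrans α, fun _ => ?_⟩
  refine (isWeightedColimit_sigma_iff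
    ((Functor.LeftExtension.mk L α).coconeAt (LawvereTheory.gen T))
    (lanLeg (sigmaTrans α) PUnit.unit) fun a w => ?_).2 (isPowerColimit_coconeAt h _)
  change α.app a ≫ L.map w = coordComparison H a ≫
    Pi.lift (f := fun _ : Fin a.arity => L.obj (LawvereTheory.gen T)) (fun j : Fin a.arity =>
      Pi.lift (f := fun _ : Fin 1 => H.obj (LawvereTheory.gen S))
        (fun _ => Pi.π (fun _ : Fin a.arity => H.obj (LawvereTheory.gen S)) j) ≫
        Pi.π (fun _ : Fin 1 => H.obj (LawvereTheory.gen S)) 0 ≫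
          α.app (LawvereTheory.gen S)) ≫
      inv (piComparison L (fun _ : Fin a.arity => LawvereTheory.gen T)) ≫
        L.map (LawvereTheory.ofOp T (LawvereTheory.homOp w))
  -- Naturality of `α` at the coordinates identifies its component at `Aⁿ` with the `n`-th power of
  -- its component at `A`.
  have e : coordComparison H a ≫ Pi.lift (f := fun _ : Fin a.arity => L.obj (LawvereTheory.gen T))
      (fun j : Fin a.arity => Pi.lift (f := fun _ : Fin 1 => H.obj (LawvereTheory.gen S))
        (fun _ => Pi.π (fun _ : Fin a.arity => H.obj (LawvereTheory.gen S)) j) ≫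
        Pi.π (fun _ : Fin 1 => H.obj (LawvereTheory.gen S)) 0 ≫
          α.app (LawvereTheory.gen S)) =
      α.app a ≫ coordComparison L ⟨a.arity⟩ := by
    apply Pi.hom_ext; intro j
    have key (β : H.obj (LawvereTheory.gen S) ⟶ L.obj (LawvereTheory.gen T)) :
        (coordComparison H a ≫ Pi.lift (f := fun _ : Fin a.arity => L.obj (LawvereTheory.gen T))
          (fun j : Fin a.arity => Pi.lift (f := fun _ : Fin 1 => H.obj (LawvereTheory.gen S))
            (fun _ => Pi.π (fun _ : Fin a.arity => H.obj (LawvereTheory.gen S)) j) ≫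
              Pi.π (fun _ : Fin 1 => H.obj (LawvereTheory.gen S)) 0 ≫ β)) ≫ Pi.π _ j =
          H.map (a.coord j) ≫ β := by
      simp [coordComparison]
    refine (key _).trans ?_
    have hL : coordComparison L ⟨a.arity⟩ ≫
        Pi.π (fun _ : Fin a.arity => L.obj (LawvereTheory.gen T)) j =
          L.map (LawvereTheory.coord ⟨a.arity⟩ j) := Pi.lift_π _ _
    refine Eq.trans ?_ ((Category.assoc _ _ _).trans (congrArg (α.app a ≫ ·) hL)).symm
    refine (α.naturality (a.coord j)).trans ?_
    refine congrArg (fun t => α.app a ≫ L.map t) ?_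
    exact LawvereTheory.Hom.ext (funext fun _ => Ops.map_var F _)
  refine Eq.trans ?_ (Category.assoc _ _ _)
  refine Eq.trans ?_ (congrArg (· ≫ _) e.symm)
  refine Eq.trans ?_ (Category.assoc _ _ _).symm
  refine congrArg (α.app a ≫ ·) ?_
  refine Eq.trans ?_ (coordComparison_comp_ofOp L (LawvereTheory.homOp w)).symm
  exact congrArg L.map (LawvereTheory.opHom_homOp w).symm

end SigmaWeighted

/-! ## Distribution over finite powers -/

theorem isColimit_powerCocone_iff {J : Type v₁} [Category.{w₁} J] {C : Type v₂} [Category.{w₂} C]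
    [HasFinitePowers C] {D : J ⥤ C} (c : Cocone D) (k : ℕ)
    [∀ a : Fin k → J, HasProduct (fun i => D.obj (a i))] :
    Nonempty (IsColimit (powerCocone c k)) ↔
      ∀ (Q : C) (s : ∀ x : Fin k → J, (∏ᶜ (fun i => D.obj (x i))) ⟶ Q),
        (∀ (x y : Fin k → J) (f : ∀ i, x i ⟶ y i),
          Limits.Pi.map (f := fun i => D.obj (x i)) (g := fun i => D.obj (y i))
            (fun i => D.map (f i)) ≫ s y = s x) →
        ∃! g : power k c.pt ⟶ Q, ∀ x : Fin k → J,
          Limits.Pi.map (f := fun i => D.obj (x i)) (g := fun _ : Fin k => c.pt) (fun i => c.ι.app (x i)) ≫ g = s x := by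
  constructor
  · rintro ⟨h⟩ Q s hs
    exact h.existsUnique (s := { pt := Q
                                 ι := { app := s
                                        naturality := fun x y f =>
                                          (hs x y f).trans (Category.comp_id _).symm } })
  · intro h
    exact ⟨IsColimit.ofExistsUnique fun s => h s.pt s.ι.app fun x y f => s.w f⟩

section Distributive

variable {C : Type v} [Category.{w₁} C] {S : CategoryTheory.Monad (Type u)}
  {E : Type v₂} [Category.{w₂} E] {G : LawvereTheory S ⥤ E} {b : E} {H : LawvereTheory S ⥤ C}
  {k : ℕ}

/-- The product of the arities of finitely many objects over `b`. -/
def costructuredSum (x : Fin k → CostructuredArrow G b) : LawvereTheory S :=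
  ⟨∑ i, (x i).left.arity⟩

/-- The projections from `costructuredSum x`. -/
def costructuredSumProj (x : Fin k → CostructuredArrow G b) (i : Fin k) :
    costructuredSum x ⟶ (x i).left :=
  LawvereTheory.sumProj (fun i => (x i).left) finSigmaFinEquiv i

/-- The identity functor presents its values as powers of `A`, so the sum of arities is a product in
the theory itself. -/
theorem exists_comp_costructuredSumProj (x : Fin k → CostructuredArrow G b) {a : LawvereTheory S}
    (u : ∀ i, a ⟶ (x i).left) :
    ∃ h : a ⟶ costructuredSum x, ∀ i, h ≫ costructuredSumProj x i = u i := by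
  have hI : PreservesCoordinates (𝟭 (LawvereTheory S)) := fun a => ⟨a.isLimitCoord⟩
  obtain ⟨h⟩ := hI.isLimit_sumProj (fun i => (x i).left) finSigmaFinEquiv
  exact ⟨Fan.IsLimit.lift h u, fun i => Fan.IsLimit.fac h u i⟩

theorem PreservesCoordinates.isLimit_costructuredSum (hH : PreservesCoordinates H)
    (x : Fin k → CostructuredArrow G b) :
    Nonempty (IsLimit (Fan.mk (f := fun i => (CostructuredArrow.proj G b ⋙ H).obj (x i))
      (H.obj (costructuredSum x)) (fun i => H.map (costructuredSumProj x i)))) :=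
  hH.isLimit_sumProj (fun i => (x i).left) finSigmaFinEquiv

section

variable (H)
variable [∀ x : Fin k → CostructuredArrow G b,
  HasProduct (fun i => (CostructuredArrow.proj G b ⋙ H).obj (x i))]

/-- The map `H a ⟶ H x₁ × ⋯ × H x_k` induced by maps `a ⟶ xᵢ`. -/
noncomputable def costructuredLift (x : Fin k → CostructuredArrow G b) {a : LawvereTheory S}
    (t : ∀ i, a ⟶ (x i).left) :
    H.obj a ⟶ ∏ᶜ (fun i => (CostructuredArrow.proj G b ⋙ H).obj (x i)) :=
  Pi.lift (f := fun i => (CostructuredArrow.proj G b ⋙ H).obj (x i)) (fun i => H.map (t i))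

theorem map_comp_costructuredLift (x : Fin k → CostructuredArrow G b) {a a' : LawvereTheory S}
    (h : a' ⟶ a) (t : ∀ i, a ⟶ (x i).left) :
    H.map h ≫ costructuredLift H x t = costructuredLift H x (fun i => h ≫ t i) := by
  apply Pi.hom_ext; intro i
  rw [Category.assoc, costructuredLift, costructuredLift, Pi.lift_π, Pi.lift_π]
  exact (H.map_comp _ _).symm

theorem costructuredLift_comp_map (x y : Fin k → CostructuredArrow G b) {a : LawvereTheory S}
    (t : ∀ i, a ⟶ (x i).left) (f : ∀ i, x i ⟶ y i) :
    costructuredLift H x t ≫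
        Limits.Pi.map (fun i => (CostructuredArrow.proj G b ⋙ H).map (f i)) =
      costructuredLift H y (fun i => t i ≫ (f i).left) := by
  apply Pi.hom_ext; intro i
  rw [Category.assoc, Limits.Pi.map_π, costructuredLift, costructuredLift, Pi.lift_π,
    Pi.lift_π_assoc]
  exact (H.map_comp _ _).symm

theorem costructuredLift_comp_ι [HasFinitePowers C] (c : Cocone (CostructuredArrow.proj G b ⋙ H))
    (x : Fin k → CostructuredArrow G b) {a : LawvereTheory S} (t : ∀ i, a ⟶ (x i).left) :
    costructuredLift H x t ≫ Limits.Pi.map (g := fun _ : Fin k => c.pt) (fun i => c.ι.app (x i)) =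
      Pi.lift (fun i => costructuredLeg c (G.map (t i) ≫ (x i).hom)) := by
  apply Pi.hom_ext; intro i
  rw [Category.assoc, Limits.Pi.map_π, costructuredLift, Pi.lift_π, Pi.lift_π_assoc]
  exact map_comp_costructuredLeg c (t i) (x i).hom

/-- Each `tᵢ` is a morphism of `G ↓ b` from `a`, with structure map `G tᵢ ≫ xᵢ`, to `xᵢ`.
Compatibility along these morphisms reduces `s` to tuples with common source `a`. -/
theorem costructuredLift_comp_natural {Q : C}
    {s : ∀ x : Fin k → CostructuredArrow G b,
      (∏ᶜ (fun i => (CostructuredArrow.proj G b ⋙ H).obj (x i))) ⟶ Q}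
    (hs : ∀ (x y : Fin k → CostructuredArrow G b) (f : ∀ i, x i ⟶ y i),
      Limits.Pi.map (fun i => (CostructuredArrow.proj G b ⋙ H).map (f i)) ≫ s y = s x)
    (x : Fin k → CostructuredArrow G b) {a : LawvereTheory S} (t : ∀ i, a ⟶ (x i).left) :
    costructuredLift H x t ≫ s x =
      costructuredLift H (fun i => CostructuredArrow.mk (G.map (t i) ≫ (x i).hom)) (fun _ => 𝟙 a) ≫
        s (fun i => CostructuredArrow.mk (G.map (t i) ≫ (x i).hom)) := by
  rw [← hs (fun i => CostructuredArrow.mk (G.map (t i) ≫ (x i).hom)) x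
    (fun i => CostructuredArrow.homMk (t i)), ← Category.assoc, costructuredLift_comp_map]
  simp

theorem PreservesCoordinates.isIso_costructuredLift {H : LawvereTheory S ⥤ C}
    (hH : PreservesCoordinates H)
    [∀ x : Fin k → CostructuredArrow G b,
      HasProduct (fun i => (CostructuredArrow.proj G b ⋙ H).obj (x i))]
    (x : Fin k → CostructuredArrow G b) :
    IsIso (costructuredLift H x (costructuredSumProj x)) := by
  obtain ⟨h⟩ := hH.isLimit_costructuredSum x
  refine ⟨Fan.IsLimit.lift h (fun i => Pi.π _ i), Fan.IsLimit.hom_ext h _ _ fun i => ?_,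
    Pi.hom_ext _ _ fun i => ?_⟩
  · rw [Category.assoc, Fan.IsLimit.fac, costructuredLift, Pi.lift_π]
    exact (Category.id_comp _).symm
  · rw [Category.assoc, costructuredLift, Pi.lift_π, Category.id_comp]
    exact Fan.IsLimit.fac h _ i

end

variable [HasFinitePowers C]

/-- Restricting a cocone under `Dᵏ` to tuples with a common source gives a power family. Nothing is
lost: `D x₁ × ⋯ × D x_k` is the value of `H` at a single object mapping to every `xᵢ`. -/
theorem IsPowerColimit.isColimit_powerCocone {c : Cocone (CostructuredArrow.proj G b ⋙ H)}
    (hc : IsPowerColimit c) (hH : PreservesCoordinates H)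
    [∀ x : Fin k → CostructuredArrow G b,
      HasProduct (fun i => (CostructuredArrow.proj G b ⋙ H).obj (x i))] :
    Nonempty (IsColimit (powerCocone c k)) := by
  rw [isColimit_powerCocone_iff]
  intro Q s hs
  obtain ⟨g, hg⟩ := hc.exists_desc (k := k) (Q := Q)
    { app := fun a w => costructuredLift H (fun i => CostructuredArrow.mk (w i)) (fun _ => 𝟙 a) ≫
        s (fun i => CostructuredArrow.mk (w i))
      naturality := fun {a a'} f w => by
        rw [← Category.assoc, map_comp_costructuredLift]
        simp only [Category.comp_id]
        exact (costructuredLift_comp_natural H hs (fun i => CostructuredArrow.mk (w i))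
          (fun _ => f)).symm }
  refine ⟨g, fun x => ?_, fun g' hg' => hc.hom_ext fun a w => ?_⟩
  · have := hH.isIso_costructuredLift x
    rw [← cancel_epi (costructuredLift H x (costructuredSumProj x)),
      costructuredLift_comp_natural H hs, ← Category.assoc, costructuredLift_comp_ι]
    exact hg _ _
  · have h := costructuredLift_comp_ι H c (fun i => CostructuredArrow.mk (w i)) (fun _ => 𝟙 a)
    simp only [CategoryTheory.Functor.map_id, Category.id_comp, CostructuredArrow.mk_hom_eq_self]
      at h
    rw [hg, ← h, Category.assoc, hg']

/-- A power family extends to a cocone under `Dᵏ`: at `x`, evaluate it at the product of the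
sources, on the projections followed by the structure maps of the `xᵢ`. -/
theorem isPowerColimit_of_isColimit_powerCocone {c : Cocone (CostructuredArrow.proj G b ⋙ H)}
    (hH : PreservesCoordinates H)
    (hc : ∀ k : ℕ, ∃ _ : ∀ x : Fin k → CostructuredArrow G b,
      HasProduct (fun i => (CostructuredArrow.proj G b ⋙ H).obj (x i)),
      Nonempty (IsColimit (powerCocone c k))) :
    IsPowerColimit c := by
  refine isPowerColimit_of_existsUnique fun k Q φ => ?_
  obtain ⟨_, hk⟩ := hc k
  rw [isColimit_powerCocone_iff] at hk
  have hI := hH.isIso_costructuredLift (G := G) (b := b) (k := k)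
  obtain ⟨g, hg, hu⟩ := hk Q (fun x => inv (costructuredLift H x (costructuredSumProj x)) ≫
    φ.app (costructuredSum x) (fun i => G.map (costructuredSumProj x i) ≫ (x i).hom)) (by
      intro x y f
      -- `h` is the product of the maps `fᵢ`; compatibility of the cocone is naturality of `φ` at
      -- `h`.
      obtain ⟨h, hh⟩ := exists_comp_costructuredSumProj y
        (fun i => costructuredSumProj x i ≫ (f i).left)
      rw [IsIso.eq_inv_comp, ← Category.assoc, costructuredLift_comp_map, ← funext hh,
        ← map_comp_costructuredLift, Category.assoc, IsIso.hom_inv_id_assoc, ← φ.naturality]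
      congr 1
      funext i
      rw [← Category.assoc, ← G.map_comp, hh, G.map_comp, Category.assoc, CostructuredArrow.w])
  refine ⟨g, fun a w => ?_, fun g' hg' => hu g' fun x => ?_⟩
  · have h := costructuredLift_comp_ι H c (fun i => CostructuredArrow.mk (w i)) (fun _ => 𝟙 a)
    simp only [CategoryTheory.Functor.map_id, Category.id_comp, CostructuredArrow.mk_hom_eq_self]
      at h
    -- `d` is the diagonal `a ⟶ aᵏ`; naturality of `φ` along it recovers the original value at `w`.
    obtain ⟨d, hd⟩ := exists_comp_costructuredSumProj (fun i => CostructuredArrow.mk (w i))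
      (fun _ => 𝟙 a)
    rw [← h, Category.assoc, hg, ← funext hd, ← map_comp_costructuredLift, Category.assoc,
      IsIso.hom_inv_id_assoc, ← φ.naturality]
    congr 1
    funext i
    rw [← Category.assoc, ← G.map_comp, hd]
    simp
  · rw [IsIso.eq_inv_comp, ← Category.assoc, costructuredLift_comp_ι]
    exact hg' _ _

/-- The powers of the vertex of a colimiting cocone represent power families iff the colimit
distributes over finite powers. -/
theorem hasDistributiveColimit_iff (hH : PreservesCoordinates H) :
    HasDistributiveColimit (CostructuredArrow.proj G b ⋙ H) ↔
      ∃ c : Cocone (CostructuredArrow.proj G b ⋙ H), IsPowerColimit c := by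
  constructor
  · rintro ⟨c, -, hc⟩
    exact ⟨c, isPowerColimit_of_isColimit_powerCocone hH hc⟩
  · rintro ⟨c, hc⟩
    refine ⟨c, hc.isColimit, fun k => ?_⟩
    have hP : ∀ x : Fin k → CostructuredArrow G b,
        HasProduct (fun i => (CostructuredArrow.proj G b ⋙ H).obj (x i)) := fun x =>
      ⟨⟨_, (hH.isLimit_costructuredSum x).some⟩⟩
    exact ⟨hP, hc.isColimit_powerCocone hH⟩

end Distributive

/-! ## The Kan extension determined by its value at the distinguished object -/

section Extension

variable {C : Type v} [Category.{w₁} C] [HasFinitePowers C] {T : CategoryTheory.Monad (Type u)}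
  {B : Type v₂} [Category.{w₂} B] {G : B ⥤ LawvereTheory T} {H : B ⥤ C}
  (c : Cocone (CostructuredArrow.proj G (LawvereTheory.gen T) ⋙ H))

/-- The map `H a ⟶ Zⁿ` corresponding to `G a ⟶ Aⁿ`, for a cocone with vertex `Z`. -/
noncomputable def powerLeg {b : LawvereTheory T} {a : B} (w : G.obj a ⟶ b) :
    H.obj a ⟶ power b.arity c.pt :=
  Pi.lift (fun i => costructuredLeg c (w ≫ b.coord i))

theorem powerLeg_π {b : LawvereTheory T} {a : B} (w : G.obj a ⟶ b) (i : Fin b.arity) :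
    powerLeg c w ≫ Pi.π _ i = costructuredLeg c (w ≫ b.coord i) :=
  Pi.lift_π _ _

theorem map_comp_powerLeg {b : LawvereTheory T} {a a' : B} (f : a ⟶ a') (w : G.obj a' ⟶ b) :
    H.map f ≫ powerLeg c w = powerLeg c (G.map f ≫ w) := by
  apply Pi.hom_ext; intro i
  rw [Category.assoc, powerLeg_π, powerLeg_π, map_comp_costructuredLeg, Category.assoc]

theorem powerLeg_tuple {b : LawvereTheory T} {a : B}
    (w : Fin b.arity → (G.obj a ⟶ LawvereTheory.gen T)) :
    powerLeg c (LawvereTheory.tuple w : G.obj a ⟶ b) =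
      Pi.lift (fun i => costructuredLeg c (w i)) := by
  apply Pi.hom_ext; intro i
  rw [powerLeg_π, Pi.lift_π, LawvereTheory.tuple_coord]

variable {c}

theorem IsPowerColimit.powerLeg_hom_ext (hc : IsPowerColimit c) {b : LawvereTheory T} {Q : C}
    {g g' : power b.arity c.pt ⟶ Q}
    (h : ∀ (a : B) (w : G.obj a ⟶ b), powerLeg c w ≫ g = powerLeg c w ≫ g') : g = g' :=
  hc.hom_ext fun a w => by
    rw [← powerLeg_tuple (b := b)]
    exact h a _

/-- A map `G a ⟶ Aⁿ` is an `n`-tuple of maps to `A`, so `φ` is a power family of exponent `n` at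
`A`. Hence `Zⁿ` has the property required of the extension at `Aⁿ`. -/
theorem IsPowerColimit.exists_powerLeg_comp_eq (hc : IsPowerColimit c) {b : LawvereTheory T}
    {Q : C} (φ : ∀ a : B, (G.obj a ⟶ b) → (H.obj a ⟶ Q))
    (hφ : ∀ (a a' : B) (f : a ⟶ a') (w : G.obj a' ⟶ b), H.map f ≫ φ a' w = φ a (G.map f ≫ w)) :
    ∃ g : power b.arity c.pt ⟶ Q, ∀ (a : B) (w : G.obj a ⟶ b), powerLeg c w ≫ g = φ a w := by
  obtain ⟨g, hg⟩ := hc.exists_desc (k := b.arity) (Q := Q)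
    { app := fun a w => φ a (LawvereTheory.tuple w)
      naturality := fun {a a'} f w => by
        rw [hφ]
        refine congrArg (φ a) (LawvereTheory.hom_ext fun i => ?_)
        rw [LawvereTheory.tuple_coord, Category.assoc, LawvereTheory.tuple_coord] }
  refine ⟨g, fun a w => ?_⟩
  refine (hg a fun i => w ≫ b.coord i).trans ?_
  exact congrArg (φ a) (LawvereTheory.hom_ext fun i => LawvereTheory.tuple_coord _ i)

/-- A cocone over `G ↓ A` the powers of whose vertex represent power families extends to a
pointwise Kan extension which preserves finite powers. -/
theorem IsPowerColimit.exists_pointwiseLeftKanExtension (hc : IsPowerColimit c) :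
    ∃ (L : LawvereTheory T ⥤ C) (α : H ⟶ G ⋙ L),
      Nonempty (Functor.LeftExtension.mk L α).IsPointwiseLeftKanExtension ∧
        PreservesFinitePowers L := by
  have hm : ∀ {b b' : LawvereTheory T} (t : b ⟶ b'),
      ∃ g : power b.arity c.pt ⟶ power b'.arity c.pt, ∀ (a : B) (w : G.obj a ⟶ b),
        powerLeg c w ≫ g = powerLeg c (w ≫ t) := fun {b b'} t =>
    hc.exists_powerLeg_comp_eq (fun a w => powerLeg c (w ≫ t)) fun a a' f w => by
      rw [map_comp_powerLeg, Category.assoc]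
  choose m hm using @hm
  let L : LawvereTheory T ⥤ C :=
    { obj := fun b => power b.arity c.pt
      map := m
      map_id := fun b => hc.powerLeg_hom_ext fun a w => by
        rw [hm, Category.comp_id, Category.comp_id]
      map_comp := fun t t' => hc.powerLeg_hom_ext fun a w => by
        rw [hm, ← Category.assoc, ← Category.assoc, hm, hm] }
  let α : H ⟶ G ⋙ L :=
    { app := fun a => powerLeg c (𝟙 (G.obj a))
      naturality := fun a a' f => by
        refine (map_comp_powerLeg c f _).trans (Eq.trans ?_ (hm (G.map f) a (𝟙 _)).symm)
        rw [Category.id_comp, Category.comp_id] }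
  have hα : ∀ {b : LawvereTheory T} {a : B} (w : G.obj a ⟶ b),
      α.app a ≫ L.map w = powerLeg c w := fun {b a} w =>
    (hm w a (𝟙 _)).trans (by rw [Category.id_comp])
  refine ⟨L, α, ⟨fun b => (?_ : Nonempty (IsColimit _)).some⟩, ?_⟩
  · refine ⟨IsColimit.ofExistsUnique fun s => ?_⟩
    obtain ⟨g, hg⟩ := hc.exists_powerLeg_comp_eq (b := b) (Q := s.pt)
      (fun a w => costructuredLeg s w) fun a a' f w => map_comp_costructuredLeg s f w
    refine ⟨g, fun x => ?_, fun g' hg' => hc.powerLeg_hom_ext fun a w => ?_⟩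
    · exact (congrArg (· ≫ g) (hα x.hom)).trans (hg x.left x.hom)
    · refine Eq.trans ?_ (hg a w).symm
      exact (congrArg (· ≫ g') (hα w)).symm.trans (hg' (CostructuredArrow.mk w))
  · refine PreservesCoordinates.preservesFinitePowers fun b => ?_
    -- The value of `L` at `A` is `Z¹` rather than `Z`, so the coordinates become the projections of
    -- `Zⁿ` only after composing with `Z¹ ≅ Z`.
    have hπ : ∀ i, L.map (b.coord i) ≫ Pi.π (fun _ : Fin 1 => c.pt) 0 =
        Pi.π (fun _ : Fin b.arity => c.pt) i := fun i =>
      hc.powerLeg_hom_ext fun a w => by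
        refine (Category.assoc _ _ _).symm.trans ((congrArg (· ≫ _) (hm (b.coord i) a w)).trans ?_)
        refine (powerLeg_π c (w ≫ b.coord i) 0).trans (Eq.trans ?_ (powerLeg_π c w i).symm)
        congr 1
        exact (LawvereTheory.comp_coord _ _).trans (LawvereTheory.opHom_homOp _)
    have hext : ∀ {Y : C} {f g : Y ⟶ power 1 c.pt},
        f ≫ Pi.π (fun _ : Fin 1 => c.pt) 0 = g ≫ Pi.π (fun _ : Fin 1 => c.pt) 0 → f = g := by
      intro Y f g h
      apply Pi.hom_ext; intro i
      rwa [Subsingleton.elim i 0]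
    refine ⟨Fan.IsLimit.mk _
      (fun s => Pi.lift (fun i => s.proj i ≫ Pi.π (fun _ : Fin 1 => c.pt) 0)) (fun s i => ?_)
      (fun s f hf => ?_)⟩
    · refine hext ?_
      refine (Category.assoc _ _ _).trans ((congrArg (_ ≫ ·) (hπ i)).trans ?_)
      exact Pi.lift_π _ _
    · refine Pi.hom_ext (f := fun _ : Fin b.arity => c.pt) _ _ fun i => ?_
      refine Eq.trans ?_ (Pi.lift_π (f := fun _ : Fin b.arity => c.pt)
        (fun i => s.proj i ≫ Pi.π (fun _ : Fin 1 => c.pt) 0) i).symm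
      refine (congrArg (f ≫ ·) (hπ i)).symm.trans ?_
      exact (Category.assoc _ _ _).symm.trans (congrArg (· ≫ _) (hf i))

end Extension

theorem mainTheorem4 {C : Type v} [Category.{u} C] [HasFinitePowers C]
    (S T : CategoryTheory.Monad (Type u))
    [PreservesFilteredColimits S.toFunctor] [PreservesFilteredColimits T.toFunctor]
    (F : S ⟶ T) :
    (∀ X : FSetFunctor (reprCat (LawvereTheory S)) (reprCat C),
      List.TFAE
        [ HasLan (reprFunctor (theoryMap F)) X,
          HasLan (sigmaMap F) ((theoryUnit S).then X),
          HasDistributiveColimit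
            (CostructuredArrow.proj (theoryMap F) (LawvereTheory.gen T) ⋙ X.ordinary),
          ∃ (L : LawvereTheory T ⥤ C) (α : X.ordinary ⟶ theoryMap F ⋙ L),
            Nonempty (Functor.LeftExtension.mk L α).IsPointwiseLeftKanExtension ∧
              PreservesFinitePowers L ]) ∧
    ((∀ X : FSetFunctor (reprCat (LawvereTheory S)) (reprCat C),
        HasLan (reprFunctor (theoryMap F)) X) →
      ∃ (Φ : FSetFunctor (reprCat (LawvereTheory S)) (reprCat C) ⥤
            FSetFunctor (reprCat (LawvereTheory T)) (reprCat C))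
        (adj : Φ ⊣ (reprFunctor (theoryMap F)).precomp (reprCat C)),
        ∀ X, IsLan (reprFunctor (theoryMap F)) X (Φ.obj X) (adj.unit.app X)) ∧
    ((∀ Y : FSetFunctor (sigmaCat S) (reprCat C), HasLan (sigmaMap F) Y) →
      ∃ (Φ : FSetFunctor (sigmaCat S) (reprCat C) ⥤ FSetFunctor (sigmaCat T) (reprCat C))
        (adj : Φ ⊣ (sigmaMap F).precomp (reprCat C)),
        ∀ Y, IsLan (sigmaMap F) Y (Φ.obj Y) (adj.unit.app Y)) := by
  refine ⟨fun X => ?_, exists_adjunction_of_hasLan _, exists_adjunction_of_hasLan _⟩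
  -- Replace `X` by `R` of its ordinary functor, to which the comparison results apply.
  have hR : HasLan (reprFunctor (theoryMap F)) X ↔
      HasLan (reprFunctor (theoryMap F)) (reprFunctor X.ordinary) :=
    iff_of_eq (congrArg _ X.reprFunctor_ordinary.symm)
  have hS : HasLan (sigmaMap F) ((theoryUnit S).then X) ↔
      HasLan (sigmaMap F) ((theoryUnit S).then (reprFunctor X.ordinary)) :=
    iff_of_eq (congrArg (fun Z => HasLan (sigmaMap F) ((theoryUnit S).then Z))
      X.reprFunctor_ordinary.symm)
  have hD := hasDistributiveColimit_iff (G := theoryMap F) (b := LawvereTheory.gen T)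
    (PreservesFinitePowers.preservesCoordinates X.ordinary)
  tfae_have 1 ↔ 4 := hR.trans hasLan_repr_iff
  tfae_have 4 → 2 := fun ⟨_, _, ⟨h⟩, _⟩ => hS.2 (hasLan_sigma h)
  tfae_have 2 → 3 := fun h => hD.2 (exists_isPowerColimit_of_hasLan_sigma (hS.1 h))
  tfae_have 3 → 4 := fun h =>
    have ⟨_, hc⟩ := hD.1 h
    hc.exists_pointwiseLeftKanExtension
  tfae_finish
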